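/- Let $N\ge 3$. Work in a coordinate chart $U\subset\mathbb R^N$ with a $C^\infty$ Riemannian metric $a_{mn}(x)$, $S(x,t)=\sqrt{a_{mn}(x)t^mt^n}$, Christoffel symbols $a^i{}_{kn}$, and curvature tensor $$a_n{}^i{}_{km}=\frac{\partial a^i{}_{nm}}{\partial x^k}-\frac{\partial a^i{}_{nk}}{\partial x^m}+a^u{}_{nm}a^i{}_{uk}-a^u{}_{nk}a^i{}_{um}.$$ Let $F(x,y)>0$ be a $C^\infty$ Finsler metric function, positively homogeneous of degree 1 in $y$, on an open set $D$ of pairs $(x,y)$, $x\in U$, $y\neq0$, that is conic in $y$. Put $y_i=\frac12\partial F^2/\partial y^i$, $g_{ij}=\partial y_i/\partial y^j$ (nondegenerate, with inverse $g^{ij}$), $l^i=y^i/F$, $l_i=y_i/F$, $C_{mnk}=\frac12\partial g_{mn}/\partial y^k$, $C^n{}_{hk}=g^{nm}C_{mhk}$. Assume that the Finsler space is conformally automorphic to the Riemannian one with constant degree $H>0$: there is a smooth fibrewise transformation $t=t(x,y)$ of $D$ onto an open set $D'$, with smooth inverse $y=y(x,t)$, such that $t(x,ky)=k^Ht(x,y)$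 for $k>0$; such that $g_{mn}(x,y)=c(x,y)\,a_{ij}(x)\,t^i_mt^j_n$ with some positive factor $c$; and such that $F(x,y)=1$ if and only if $S(x,t(x,y))=1$. Here $t^i_m=\partial t^i/\partial y^m$, $t^h_{km}=\partial t^h_k/\partial y^m$, $y^n_m=\partial y^n/\partial t^m$ (taken at $t=t(x,y)$). Put $p=\frac1HF^{1-H}$. Define $$N^m{}_n=-y^m_i\Bigl(\frac{\partial t^i}{\partial x^n}+a^i{}_{kn}t^k\Bigr),\qquad D^n{}_{ij}=-\frac{\partial N^n{}_i}{\partial y^j},\qquad d_i=\frac{\partial}{\partial x^i}+N^k{}_i\frac{\partial}{\partial y^k},$$ $$M^n{}_{ij}=d_iN^n{}_j-d_jN^n{}_i,\qquad E_k{}^n{}_{ij}=d_iD^n{}_{jk}-d_jD^n{}_{ik}+D^m{}_{jk}D^n{}_{im}-D^m{}_{ik}D^n{}_{jm},$$ $$\rho_k{}^n{}_{ij}=E_k{}^n{}_{ij}-M^h{}_{ij}C^n{}_{hk}.$$ Write $\rho_{knij}=g_{mn}\rho_k{}^m{}_{ij}$, $M_{nij}=g_{nm}M^m{}_{ij}$,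 $a_{hlij}=a_{lr}a_h{}^r{}_{ij}$. The last two indices $i,j$ of $\rho$, $M$ and $a$, and the first index of $a$, are raised with $a^{mn}$; the first index of $\rho$ is raised with $g^{mn}$: $\rho^{knij}=g^{qk}a^{mi}a^{rj}\rho_q{}^n{}_{mr}$, $M^{nij}=a^{hi}a^{rj}M^n{}_{hr}$, $a_l{}^{nij}=a^{mi}a^{rj}a_l{}^n{}_{mr}$, $a^{hnij}=a^{hl}a_l{}^{nij}$. The covariant derivatives are $$\mathcal D_kM^n{}_{ij}=d_kM^n{}_{ij}+D^n{}_{kt}M^t{}_{ij}-a^s{}_{ki}M^n{}_{sj}-a^s{}_{kj}M^n{}_{is},$$ $$\mathcal D_l\rho_k{}^n{}_{ij}=d_l\rho_k{}^n{}_{ij}+D^n{}_{lt}\rho_k{}^t{}_{ij}-D^t{}_{lk}\rho_t{}^n{}_{ij}-a^s{}_{li}\rho_k{}^n{}_{sj}-a^s{}_{lj}\rho_k{}^n{}_{is}.$$ Then, at every point $(x,y)\in D$ and for all values of the free indices, with $t=t(x,y)$ and $S=S(x,t)$: 1. $M^n{}_{ij}=-y^n_t\,t^h\,a_h{}^t{}_{ij}$;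 2. $E_k{}^n{}_{ij}=y^n_h\,t^h_{km}M^m{}_{ij}+y^n_m\,a_h{}^m{}_{ij}\,t^h_k$; 3. $\rho_{knij}=-(1-H)\frac1F(l_kM_{nij}-l_nM_{kij})+p^2a_{hlij}t^h_kt^l_n$; 4. $\rho_k{}^n{}_{ij}=-(1-H)\frac1F(l_k\delta^n_m-l^ng_{mk})M^m{}_{ij}+y^n_m\,a_h{}^m{}_{ij}\,t^h_k$; 5. $\rho^{knij}=-(1-H)\frac1F(l^kM^{nij}-l^nM^{kij})+\frac1{p^2}y^k_hy^n_ra^{hrij}$; 6. $M_{nij}=-p^2t^ht^m_na_{hmij}$; 7. $M^{nij}M_{nij}=p^2\,t^la_l{}^{nij}\,t^ha_{hnij}$; 8. $\rho_{mnij}=-\rho_{nmij}$; 9. $\mathcal D_kM^n{}_{ij}+\mathcal D_jM^n{}_{ki}+\mathcal D_iM^n{}_{jk}=0$; 10. $\mathcal D_l\rho_k{}^n{}_{ij}+\mathcal D_j\rho_k{}^n{}_{li}+\mathcal D_i\rho_k{}^n{}_{jl}=0$; 11. $\rho^{knij}\rho_{knij}=a^{knij}a_{knij}+\frac2{S^2}\left(\frac1{H^2}-1\right)t^la_l{}^{nij}\,t^ha_{hnij}$.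 -/

import Mathlib

open scoped BigOperators ContDiff

/-- Local coordinates: points `x` of a chart, or components of tangent vectors. -/
abbrev Coord (N : ℕ) := Fin N → ℝ

namespace FinslerAngle

variable {N : ℕ}

/-! ### Partial derivatives -/

/-- `∂f/∂x^i` of a function of one point. -/
noncomputable def pd (f : Coord N → ℝ) (i : Fin N) (x : Coord N) : ℝ :=
  fderiv ℝ f x (Pi.single i 1)

/-- `∂f/∂x^i` of a function `f(x, y)`, with `y` fixed. -/
noncomputable def pdX (f : Coord N → Coord N → ℝ) (i : Fin N) (x y : Coord N) : ℝ :=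
  pd (fun x' => f x' y) i x

/-- `∂f/∂y^i` of a function `f(x, y)`, with `x` fixed. -/
noncomputable def pdY (f : Coord N → Coord N → ℝ) (i : Fin N) (x y : Coord N) : ℝ :=
  pd (fun y' => f x y') i y

/-! ### Finsler metric tensor of a metric function `F(x, y)` -/

/-- `y_i = (1/2) ∂F²/∂y^i`. -/
noncomputable def covector (F : Coord N → Coord N → ℝ) (i : Fin N) (x y : Coord N) : ℝ :=
  (1 / 2) * pdY (fun x y => F x y ^ 2) i x y

/-- `g_{ij} = ∂y_i/∂y^j = (1/2) ∂²F²/∂y^i∂y^j`, as a matrix. -/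
noncomputable def metric (F : Coord N → Coord N → ℝ) (x y : Coord N) :
    Matrix (Fin N) (Fin N) ℝ :=
  Matrix.of fun i j => pdY (covector F i) j x y

/-! ### Riemannian objects of a metric tensor `a_{mn}(x)` -/

/-- `S(x, t) = √(a_{mn}(x) t^m t^n)`. -/
noncomputable def riemNorm (a : Coord N → Matrix (Fin N) (Fin N) ℝ) (x t : Coord N) : ℝ :=
  Real.sqrt (∑ m, ∑ n, a x m n * t m * t n)

/-- Christoffel symbols
`a^i_{kn} = (1/2) a^{ih} (∂a_{hk}/∂x^n + ∂a_{hn}/∂x^k - ∂a_{kn}/∂x^h)`. -/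
noncomputable def christoffel (a : Coord N → Matrix (Fin N) (Fin N) ℝ)
    (i k n : Fin N) (x : Coord N) : ℝ :=
  (1 / 2) * ∑ h, (a x)⁻¹ i h *
    (pd (fun x => a x h k) n x + pd (fun x => a x h n) k x - pd (fun x => a x k n) h x)

/-- Riemannian curvature tensor `a_n^i_{km}
= ∂a^i_{nm}/∂x^k - ∂a^i_{nk}/∂x^m + a^u_{nm} a^i_{uk} - a^u_{nk} a^i_{um}`. -/
noncomputable def riemCurv (a : Coord N → Matrix (Fin N) (Fin N) ℝ)
    (n i k m : Fin N) (x : Coord N) : ℝ :=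
  pd (christoffel a i n m) k x - pd (christoffel a i n k) m x
    + ∑ u, (christoffel a u n m x * christoffel a i u k x
      - christoffel a u n k x * christoffel a i u m x)

/-- `a_{hlij} = a_{lr} a_h^r_{ij}`. -/
noncomputable def riemCurvLow (a : Coord N → Matrix (Fin N) (Fin N) ℝ)
    (h l i j : Fin N) (x : Coord N) : ℝ :=
  ∑ r, a x l r * riemCurv a h r i j x

/-- `a_h^{nij} = a^{mi} a^{rj} a_h^n_{mr}`. -/
noncomputable def riemCurvMid (a : Coord N → Matrix (Fin N) (Fin N) ℝ)
    (h n i j : Fin N) (x : Coord N) : ℝ :=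
  ∑ m, ∑ r, (a x)⁻¹ m i * (a x)⁻¹ r j * riemCurv a h n m r x

/-- `a^{hrij} = a^{hl} a_l^{rij} = a^{hl} a^{mi} a^{nj} a_l^r_{mn}`. -/
noncomputable def riemCurvUp (a : Coord N → Matrix (Fin N) (Fin N) ℝ)
    (h r i j : Fin N) (x : Coord N) : ℝ :=
  ∑ l, (a x)⁻¹ h l * riemCurvMid a l r i j x

end FinslerAngle

open FinslerAngle

/-- A Finsler space which is conformally automorphic, with constant degree `H`, to a Riemannian
space, in a coordinate chart `U ⊆ ℝ^N` and over an open conic domain `D` of nonzero tangent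
vectors. The transformation is `t = t(x, y)`, with inverse `y = y(x, t)`. -/
structure ConformallyAutomorphicSpace (N : ℕ) where
  /-- the chart domain -/
  U : Set (Coord N)
  isOpen_U : IsOpen U
  /-- the Riemannian metric tensor `a_{mn}(x)` -/
  a : Coord N → Matrix (Fin N) (Fin N) ℝ
  smooth_a : ∀ m n, ContDiffOn ℝ ∞ (fun x => a x m n) U
  posDef_a : ∀ x ∈ U, (a x).PosDef
  /-- the domain of tangent vectors `(x, y)` of the Finsler space -/
  D : Set (Coord N × Coord N)
  isOpen_D : IsOpen D
  mem_U_of_mem_D : ∀ x y, (x, y) ∈ D → x ∈ U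
  ne_zero_of_mem_D : ∀ x y, (x, y) ∈ D → y ≠ 0
  smul_mem_D : ∀ x y, (x, y) ∈ D → ∀ k : ℝ, 0 < k → (x, k • y) ∈ D
  /-- the Finsler metric function -/
  F : Coord N → Coord N → ℝ
  smooth_F : ContDiffOn ℝ ∞ (fun z : Coord N × Coord N => F z.1 z.2) D
  F_pos : ∀ x y, (x, y) ∈ D → 0 < F x y
  F_homog : ∀ x y, (x, y) ∈ D → ∀ k : ℝ, 0 < k → F x (k • y) = k * F x y
  metric_nondegenerate : ∀ x y, (x, y) ∈ D → (metric F x y).det ≠ 0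
  /-- the domain of the transformed vectors `(x, t)` -/
  D' : Set (Coord N × Coord N)
  isOpen_D' : IsOpen D'
  /-- the transformation `y ↦ t` in each tangent space -/
  t : Coord N → Coord N → Coord N
  /-- the inverse transformation `t ↦ y` in each tangent space -/
  yInv : Coord N → Coord N → Coord N
  smooth_t : ContDiffOn ℝ ∞ (fun z : Coord N × Coord N => t z.1 z.2) D
  smooth_yInv : ContDiffOn ℝ ∞ (fun z : Coord N × Coord N => yInv z.1 z.2) D'
  t_mem : ∀ x y, (x, y) ∈ D → (x, t x y) ∈ D'
  yInv_mem : ∀ x τ, (x, τ) ∈ D' → (x, yInv x τ) ∈ D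
  left_inv : ∀ x y, (x, y) ∈ D → yInv x (t x y) = y
  right_inv : ∀ x τ, (x, τ) ∈ D' → t x (yInv x τ) = τ
  /-- the degree of conformal automorphism, a constant -/
  H : ℝ
  H_pos : 0 < H
  t_homog : ∀ x y, (x, y) ∈ D → ∀ k : ℝ, 0 < k → t x (k • y) = k ^ H • t x y
  /-- in each tangent space the Finsler metric tensor is conformal to the pull-back of the
  Riemannian one -/
  conformal : ∃ c : Coord N → Coord N → ℝ, ∀ x y, (x, y) ∈ D → 0 < c x y ∧
    ∀ m n, metric F x y m n = c x y * ∑ i, ∑ j, a x i j *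
      pdY (fun x y => t x y i) m x y * pdY (fun x y => t x y j) n x y
  /-- the indicatrix corresponds to the Riemannian unit sphere -/
  indicatrix : ∀ x y, (x, y) ∈ D → (F x y = 1 ↔ riemNorm a x (t x y) = 1)

namespace ConformallyAutomorphicSpace

variable {N : ℕ} (A : ConformallyAutomorphicSpace N)

/-! ### Algebraic objects -/

/-- `p = F^{1-H} / H`. -/
noncomputable def p (x y : Coord N) : ℝ := (1 / A.H) * A.F x y ^ (1 - A.H)

/-- `g_{ij}`. -/
noncomputable def g (i j : Fin N) (x y : Coord N) : ℝ := metric A.F x y i j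

/-- `g^{ij}`, the reciprocal tensor. -/
noncomputable def gUp (i j : Fin N) (x y : Coord N) : ℝ := (metric A.F x y)⁻¹ i j

/-- `a^{ij}`, the reciprocal tensor. -/
noncomputable def aUp (i j : Fin N) (x : Coord N) : ℝ := (A.a x)⁻¹ i j

/-- `l_k = y_k / F`. -/
noncomputable def lLow (k : Fin N) (x y : Coord N) : ℝ := covector A.F k x y / A.F x y

/-- `l^k = y^k / F`. -/
noncomputable def lUp (k : Fin N) (x y : Coord N) : ℝ := y k / A.F x y

/-- Cartan tensor `C_{mnk} = (1/2) ∂g_{mn}/∂y^k`. -/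
noncomputable def C (m n k : Fin N) (x y : Coord N) : ℝ := (1 / 2) * pdY (A.g m n) k x y

/-- `C^n_{hk} = g^{nm} C_{mhk}`. -/
noncomputable def CUp (n h k : Fin N) (x y : Coord N) : ℝ :=
  ∑ m, A.gUp n m x y * A.C m h k x y

/-- `t^m_k = ∂t^m/∂y^k`. -/
noncomputable def tD (m k : Fin N) (x y : Coord N) : ℝ := pdY (fun x y => A.t x y m) k x y

/-- `t^h_{km} = ∂t^h_k/∂y^m`. -/
noncomputable def tDD (h k m : Fin N) (x y : Coord N) : ℝ := pdY (A.tD h k) m x y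

/-- `y^n_m = ∂y^n/∂t^m`, taken at `t = t(x, y)`. -/
noncomputable def yD (n m : Fin N) (x y : Coord N) : ℝ :=
  pdY (fun x τ => A.yInv x τ n) m x (A.t x y)

/-! ### The connection -/

/-- `N^m_n = -y^m_i (∂t^i/∂x^n + a^i_{kn} t^k)`. -/
noncomputable def Nc (m n : Fin N) (x y : Coord N) : ℝ :=
  -∑ i, A.yD m i x y *
    (pdX (fun x y => A.t x y i) n x y + ∑ k, christoffel A.a i k n x * A.t x y k)

/-- `D^n_{ij} = -∂N^n_i/∂y^j`. -/
noncomputable def Dc (n i j : Fin N) (x y : Coord N) : ℝ := -pdY (A.Nc n i) j x y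

/-- The operator `d_i = ∂/∂x^i + N^k_i ∂/∂y^k`. -/
noncomputable def d (i : Fin N) (f : Coord N → Coord N → ℝ) (x y : Coord N) : ℝ :=
  pdX f i x y + ∑ k, A.Nc k i x y * pdY f k x y

/-! ### Curvature objects -/

/-- `M^n_{ij} = d_i N^n_j - d_j N^n_i`. -/
noncomputable def M (n i j : Fin N) (x y : Coord N) : ℝ :=
  A.d i (A.Nc n j) x y - A.d j (A.Nc n i) x y

/-- `E_k^n_{ij} = d_i D^n_{jk} - d_j D^n_{ik} + D^m_{jk} D^n_{im} - D^m_{ik} D^n_{jm}`. -/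
noncomputable def E (k n i j : Fin N) (x y : Coord N) : ℝ :=
  A.d i (A.Dc n j k) x y - A.d j (A.Dc n i k) x y
    + ∑ m, (A.Dc m j k x y * A.Dc n i m x y - A.Dc m i k x y * A.Dc n j m x y)

/-- The curvature tensor `ρ_k^n_{ij} = E_k^n_{ij} - M^h_{ij} C^n_{hk}`. -/
noncomputable def rho (k n i j : Fin N) (x y : Coord N) : ℝ :=
  A.E k n i j x y - ∑ h, A.M h i j x y * A.CUp n h k x y

/-- `ρ_{knij} = g_{mn} ρ_k^m_{ij}`. -/
noncomputable def rhoLow (k n i j : Fin N) (x y : Coord N) : ℝ :=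
  ∑ m, A.g m n x y * A.rho k m i j x y

/-- `ρ^{knij} = g^{pk} a^{mi} a^{rj} ρ_p^n_{mr}`. -/
noncomputable def rhoUp (k n i j : Fin N) (x y : Coord N) : ℝ :=
  ∑ q, ∑ m, ∑ r, A.gUp q k x y * A.aUp m i x * A.aUp r j x * A.rho q n m r x y

/-- `M_{nij} = g_{nm} M^m_{ij}`. -/
noncomputable def MLow (n i j : Fin N) (x y : Coord N) : ℝ :=
  ∑ m, A.g n m x y * A.M m i j x y

/-- `M^{mij} = a^{hi} a^{nj} M^m_{hn}`. -/
noncomputable def MUp (m i j : Fin N) (x y : Coord N) : ℝ :=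
  ∑ h, ∑ n, A.aUp h i x * A.aUp n j x * A.M m h n x y

/-- The covariant derivative `𝒟_k M^n_{ij}
= d_k M^n_{ij} + D^n_{kt} M^t_{ij} - a^s_{ki} M^n_{sj} - a^s_{kj} M^n_{is}`. -/
noncomputable def covM (k n i j : Fin N) (x y : Coord N) : ℝ :=
  A.d k (A.M n i j) x y + ∑ s, A.Dc n k s x y * A.M s i j x y
    - ∑ s, christoffel A.a s k i x * A.M n s j x y
    - ∑ s, christoffel A.a s k j x * A.M n i s x y

/-- The covariant derivative `𝒟_l ρ_k^n_{ij} = d_l ρ_k^n_{ij} + D^n_{lt} ρ_k^t_{ij}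
- D^t_{lk} ρ_t^n_{ij} - a^s_{li} ρ_k^n_{sj} - a^s_{lj} ρ_k^n_{is}`. -/
noncomputable def covRho (l k n i j : Fin N) (x y : Coord N) : ℝ :=
  A.d l (A.rho k n i j) x y + ∑ s, A.Dc n l s x y * A.rho k s i j x y
    - ∑ s, A.Dc s l k x y * A.rho s n i j x y
    - ∑ s, christoffel A.a s l i x * A.rho k n s j x y
    - ∑ s, christoffel A.a s l j x * A.rho k n i s x y

/-- The scalar `t^l a_l^{nij} t^h a_{hnij}`. -/
noncomputable def Q (x y : Coord N) : ℝ :=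
  ∑ l, ∑ h, ∑ n, ∑ i, ∑ j, A.t x y l * riemCurvMid A.a l n i j x *
    (A.t x y h * riemCurvLow A.a h n i j x)

end ConformallyAutomorphicSpace

/-!
`N` is chosen so that `t` is horizontal, `d_i t = -Γ_i t`. Commuting two horizontal derivations
turns this into `T M_ij = -R_ij t`, and a fibre derivative of the latter gives `E`. Homogeneity and
the indicatrix condition force the conformal factor to be `p²`, so `g = p² Tᵀ a T`. Since the Cartan
tensor is totally symmetric, a Koszul permutation expresses `T⁻¹ ∂T` through it, whence
`ρ_ij = T⁻¹ Φ(R_ij) T` for a linear map `Φ` built from `t`, `a` and the coefficient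
`(1 - H) / (H S²)`, all of which are horizontally constant. So `Φ` commutes with covariant
differentiation, preserves skew-adjointness and has an explicit trace form: the skew symmetry, the
Bianchi identities and the norm identity are transported from the Riemannian curvature.
-/

/-! ### Smooth functions on an open set -/

namespace FinslerAngle

section SmoothFunctions

open TopologicalSpace
open scoped Manifold

variable {W : Type*} [NormedAddCommGroup W] [NormedSpace ℝ W] {Ω : Opens W}

/-- The algebra of smooth real functions on an open set of a normed space. It is not reducible to
`ContMDiffMap`, so that its ring operations are opaque to unification. -/
def SmoothFun (Ω : Opens W) : Type _ := C^∞⟮𝓘(ℝ, W), Ω; 𝓘(ℝ), ℝ⟯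

namespace SmoothFun

noncomputable instance : CommRing (SmoothFun Ω) :=
  inferInstanceAs (CommRing C^∞⟮𝓘(ℝ, W), Ω; 𝓘(ℝ), ℝ⟯)

noncomputable instance : Algebra ℝ (SmoothFun Ω) :=
  inferInstanceAs (Algebra ℝ C^∞⟮𝓘(ℝ, W), Ω; 𝓘(ℝ), ℝ⟯)

instance : IsAddTorsionFree (SmoothFun Ω) :=
  letI : Module ℚ (SmoothFun Ω) := Module.compHom _ (algebraMap ℚ ℝ)
  .of_module_rat _

/-- Evaluation of smooth functions at a point, as a homomorphism of algebras. -/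
noncomputable def eval (z : Ω) : SmoothFun Ω →ₐ[ℝ] ℝ :=
  (Pi.evalAlgHom ℝ (fun _ : Ω => ℝ) z).comp ContMDiffMap.coeFnAlgHom

theorem ext_eval {φ ψ : SmoothFun Ω} (h : ∀ z, eval z φ = eval z ψ) : φ = ψ :=
  ContMDiffMap.ext h

theorem contDiffOn_of_eq_eval {φ : SmoothFun Ω} {f : W → ℝ} (h : ∀ z : Ω, f z = eval z φ) :
    ContDiffOn ℝ ∞ f Ω := by
  rw [← contMDiffOn_iff_contDiffOn]
  intro z hz
  have hφ : ContMDiff 𝓘(ℝ, W) 𝓘(ℝ) ∞ fun z : Ω => f z := by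
    rw [funext h]
    exact ContMDiffMap.contMDiff (n := ∞) φ
  exact (contMDiffAt_subtype_iff.1 (hφ ⟨z, hz⟩)).contMDiffWithinAt

/-- The restriction to `Ω` of a function which is smooth on `Ω`. -/
def ofContDiffOn (f : W → ℝ) (hf : ContDiffOn ℝ ∞ f Ω) : SmoothFun Ω :=
  (⟨fun z => f z, fun z => contMDiffAt_subtype_iff.2
    (contMDiffOn_iff_contDiffOn.2 hf |>.contMDiffAt (Ω.isOpen.mem_nhds z.2))⟩ :
    C^∞⟮𝓘(ℝ, W), Ω; 𝓘(ℝ), ℝ⟯)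

theorem eval_ofContDiffOn {f : W → ℝ} (hf : ContDiffOn ℝ ∞ f Ω) (z : Ω) :
    eval z (ofContDiffOn f hf) = f z :=
  rfl

/-- The extension of a smooth function on `Ω` by zero to the whole space, to which the Fréchet
derivative applies. -/
noncomputable def extend (φ : SmoothFun Ω) : W → ℝ :=
  Function.extend Subtype.val (fun z : Ω => eval z φ) 0

theorem extend_apply (φ : SmoothFun Ω) (z : Ω) : extend φ z = eval z φ :=
  Subtype.val_injective.extend_apply _ _ z

theorem contDiffOn_extend (φ : SmoothFun Ω) : ContDiffOn ℝ ∞ (extend φ) Ω :=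
  contDiffOn_of_eq_eval (extend_apply φ)

theorem contDiffAt_extend (φ : SmoothFun Ω) (z : Ω) : ContDiffAt ℝ ∞ (extend φ) z :=
  (contDiffOn_extend φ).contDiffAt (Ω.isOpen.mem_nhds z.2)

theorem differentiableAt_extend (φ : SmoothFun Ω) (z : Ω) : DifferentiableAt ℝ (extend φ) z :=
  (contDiffAt_extend φ z).differentiableAt (by simp)

theorem fderiv_extend {φ : SmoothFun Ω} {f : W → ℝ} (h : ∀ z : Ω, f z = eval z φ) (z : Ω) :
    fderiv ℝ (extend φ) z = fderiv ℝ f z := by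
  apply Filter.EventuallyEq.fderiv_eq
  filter_upwards [Ω.isOpen.mem_nhds z.2] with w hw
  exact (extend_apply φ ⟨w, hw⟩).trans (h ⟨w, hw⟩).symm

theorem contDiffOn_fderiv_extend (v : W) (φ : SmoothFun Ω) :
    ContDiffOn ℝ ∞ (fun z => fderiv ℝ (extend φ) z v) Ω :=
  ((contDiffOn_extend φ).fderiv_of_isOpen Ω.isOpen (m := ∞) (by simp)).clm_apply contDiffOn_const

/-- The derivative in the direction of the constant vector field `v`. -/
noncomputable def dirDeriv (v : W) : Derivation ℝ (SmoothFun Ω) (SmoothFun Ω) :=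
  Derivation.mk'
    { toFun := fun φ => ofContDiffOn _ (contDiffOn_fderiv_extend v φ)
      map_add' := fun φ ψ => ext_eval fun z => by
        have hsum (w : Ω) : (extend φ + extend ψ) w = eval w (φ + ψ) := by
          rw [Pi.add_apply, map_add, extend_apply, extend_apply]
        simp only [map_add, eval_ofContDiffOn, fderiv_extend hsum,
          fderiv_add (differentiableAt_extend φ z) (differentiableAt_extend ψ z),
          add_apply]
      map_smul' := fun r φ => ext_eval fun z => by
        have hsmul (w : Ω) : (r • extend φ) w = eval w (r • φ) := by
          rw [Pi.smul_apply, map_smul, extend_apply]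
        simp only [map_smul, eval_ofContDiffOn, fderiv_extend hsmul,
          fderiv_const_smul (differentiableAt_extend φ z), smul_apply,
          RingHom.id_apply] }
    fun φ ψ => ext_eval fun z => by
      have hmul (w : Ω) : (extend φ * extend ψ) w = eval w (φ * ψ) := by
        rw [Pi.mul_apply, map_mul, extend_apply, extend_apply]
      simp only [LinearMap.coe_mk, AddHom.coe_mk, map_add, smul_eq_mul, map_mul,
        eval_ofContDiffOn, fderiv_extend hmul,
        fderiv_mul (differentiableAt_extend φ z) (differentiableAt_extend ψ z),
        add_apply, smul_apply, extend_apply]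

theorem eval_dirDeriv {φ : SmoothFun Ω} {f : W → ℝ} (h : ∀ z : Ω, f z = eval z φ) (v : W)
    (z : Ω) : eval z (dirDeriv v φ) = fderiv ℝ f z v := by
  rw [← fderiv_extend h]
  exact eval_ofContDiffOn (contDiffOn_fderiv_extend v φ) z

theorem eval_dirDeriv_dirDeriv (v w : W) (φ : SmoothFun Ω) (z : Ω) :
    eval z (dirDeriv v (dirDeriv w φ)) = fderiv ℝ (fderiv ℝ (extend φ)) z v w := by
  have hφ : DifferentiableAt ℝ (fderiv ℝ (extend φ)) z :=
    ((contDiffAt_extend φ z).fderiv_right (m := 1) (by norm_cast)).differentiableAt (by simp)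
  rw [eval_dirDeriv (f := fun u => fderiv ℝ (extend φ) u w)
      fun u => (eval_dirDeriv (extend_apply φ) w u).symm,
    fderiv_clm_apply hφ (differentiableAt_const _)]
  simp

theorem dirDeriv_comm (v w : W) (φ : SmoothFun Ω) :
    dirDeriv v (dirDeriv w φ) = dirDeriv w (dirDeriv v φ) := by
  refine ext_eval fun z => ?_
  have hsymm : IsSymmSndFDerivAt ℝ (extend φ) (z : W) :=
    (contDiffAt_extend φ z).isSymmSndFDerivAt (by
      simpa using (WithTop.coe_le_coe.2 le_top : ((2 : ℕ∞) : WithTop ℕ∞) ≤ ∞))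
  simpa only [eval_dirDeriv_dirDeriv] using hsymm.eq v w

theorem isUnit_of_eval_ne_zero {φ : SmoothFun Ω} (h : ∀ z, eval z φ ≠ 0) : IsUnit φ := by
  have hinv : ContDiffOn ℝ ∞ (fun z => (extend φ z)⁻¹) Ω :=
    (contDiffOn_extend φ).inv fun z hz => by
      rw [extend_apply φ ⟨z, hz⟩]
      exact h _
  refine IsUnit.of_mul_eq_one (ofContDiffOn _ hinv) (ext_eval fun z => ?_)
  rw [map_mul, eval_ofContDiffOn, extend_apply, map_one, mul_inv_cancel₀ (h z)]

theorem isUnit_det_of_eval {n : Type*} [Fintype n] [DecidableEq n]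
    {B : Matrix n n (SmoothFun Ω)} (h : ∀ z, (B.map (eval z)).det ≠ 0) : IsUnit B.det :=
  isUnit_of_eval_ne_zero fun z => by
    rw [AlgHom.map_det]
    exact h z

theorem map_eval_inv {n : Type*} [Fintype n] [DecidableEq n] {B : Matrix n n (SmoothFun Ω)}
    (hB : IsUnit B.det) (z : Ω) : B⁻¹.map (eval z) = (B.map (eval z))⁻¹ := by
  refine (Matrix.inv_eq_right_inv ?_).symm
  rw [← Matrix.map_mul, Matrix.mul_nonsing_inv _ hB, Matrix.map_one _ (map_zero _) (map_one _)]

end SmoothFun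

end SmoothFunctions

section JacobianMatrix

variable {m n : ℕ}

/-- The Jacobian matrix `(∂f^i/∂y^k)_{ik}` of a map between coordinate spaces. -/
noncomputable def jacobian (f : Coord n → Coord m) (y : Coord n) : Matrix (Fin m) (Fin n) ℝ :=
  Matrix.of fun i k => pd (fun y => f y i) k y

theorem jacobian_eq_toMatrix' {f : Coord n → Coord m} {y : Coord n} (hf : DifferentiableAt ℝ f y) :
    jacobian f y = LinearMap.toMatrix' (fderiv ℝ f y : Coord n →ₗ[ℝ] Coord m) := by
  ext i k
  rw [jacobian, Matrix.of_apply, pd, fderiv_apply hf, LinearMap.toMatrix'_apply]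
  rfl

theorem jacobian_mul_jacobian_eq_one {f : Coord n → Coord m} {f' : Coord m → Coord n} {y : Coord n}
    (hf : DifferentiableAt ℝ f y) (hf' : DifferentiableAt ℝ f' (f y))
    (hid : f' ∘ f =ᶠ[nhds y] id) : jacobian f' (f y) * jacobian f y = 1 := by
  have hcomp : (fderiv ℝ f' (f y)).comp (fderiv ℝ f y) = ContinuousLinearMap.id ℝ (Coord n) := by
    rw [← fderiv_comp y hf' hf, hid.fderiv_eq, fderiv_id]
  rw [jacobian_eq_toMatrix' hf, jacobian_eq_toMatrix' hf', ← LinearMap.toMatrix'_comp,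
    ← ContinuousLinearMap.toLinearMap_comp, hcomp, ContinuousLinearMap.coe_id,
    LinearMap.toMatrix'_id]

theorem fderiv_eq_sum_pd (f : Coord n → ℝ) (y v : Coord n) :
    fderiv ℝ f y v = ∑ i, pd f i y * v i := by
  conv_lhs => rw [← Finset.univ_sum_single v, map_sum]
  refine Finset.sum_congr rfl fun i _ => ?_
  rw [pd, mul_comm, ← smul_eq_mul, ← map_smul, ← Pi.single_smul, smul_eq_mul, mul_one]

end JacobianMatrix

theorem fderiv_apply_self_of_homogeneous {E : Type*} [NormedAddCommGroup E] [NormedSpace ℝ E]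
    {f : E → ℝ} {y : E} {α : ℝ} (hd : DifferentiableAt ℝ f y)
    (hf : ∀ k : ℝ, 0 < k → f (k • y) = k ^ α * f y) : fderiv ℝ f y y = α * f y := by
  have hray : HasDerivAt (fun k : ℝ => f (k • y)) (fderiv ℝ f y y) 1 := by
    have hline : HasDerivAt (fun k : ℝ => k • y) y 1 := by
      simpa using (hasDerivAt_id (1 : ℝ)).smul_const y
    refine HasFDerivAt.comp_hasDerivAt 1 ?_ hline
    rw [one_smul]
    exact hd.hasFDerivAt
  have hpow : HasDerivAt (fun k : ℝ => k ^ α * f y) (α * f y) 1 := by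
    simpa using
      (Real.hasDerivAt_rpow_const (x := 1) (p := α) (Or.inl one_ne_zero)).mul_const (f y)
  refine hray.unique (hpow.congr_of_eventuallyEq ?_)
  filter_upwards [lt_mem_nhds (zero_lt_one' ℝ)] with k hk using hf k hk

section Represents

open SmoothFun TopologicalSpace

variable {N : ℕ} {Ω : Opens (Coord N × Coord N)}

/-- The function `f(x, y)` agrees on `Ω` with the smooth function `φ`; it may take any values
outside `Ω`. -/
def Represents (f : Coord N → Coord N → ℝ) (φ : SmoothFun Ω) : Prop :=
  ∀ z : Ω, f z.1.1 z.1.2 = eval z φ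

/-- The operator `∂/∂x^i` on smooth functions of `(x, y)`. -/
noncomputable def derivX (i : Fin N) : Derivation ℝ (SmoothFun Ω) (SmoothFun Ω) :=
  dirDeriv (Pi.single i 1, 0)

/-- The operator `∂/∂y^i` on smooth functions of `(x, y)`. -/
noncomputable def derivY (i : Fin N) : Derivation ℝ (SmoothFun Ω) (SmoothFun Ω) :=
  dirDeriv (0, Pi.single i 1)

/-- The fibre coordinate `y^i`. -/
noncomputable def coordY (i : Fin N) : SmoothFun Ω :=
  ofContDiffOn (fun z => z.2 i) (contDiffOn_pi.1 contDiffOn_snd i)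

theorem represents_coordY (i : Fin N) : Represents (fun _ y => y i) (coordY i : SmoothFun Ω) :=
  fun _ => rfl

namespace Represents

variable {f g : Coord N → Coord N → ℝ} {φ ψ : SmoothFun Ω}

theorem add (hf : Represents f φ) (hg : Represents g ψ) :
    Represents (fun x y => f x y + g x y) (φ + ψ) :=
  fun z => by simp only [map_add, hf z, hg z]

theorem sub (hf : Represents f φ) (hg : Represents g ψ) :
    Represents (fun x y => f x y - g x y) (φ - ψ) :=
  fun z => by simp only [map_sub, hf z, hg z]

theorem mul (hf : Represents f φ) (hg : Represents g ψ) :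
    Represents (fun x y => f x y * g x y) (φ * ψ) :=
  fun z => by simp only [map_mul, hf z, hg z]

theorem neg (hf : Represents f φ) : Represents (fun x y => -f x y) (-φ) :=
  fun z => by simp only [map_neg, hf z]

theorem pow (hf : Represents f φ) (k : ℕ) : Represents (fun x y => f x y ^ k) (φ ^ k) :=
  fun z => by simp only [map_pow, hf z]

theorem const_mul (c : ℝ) (hf : Represents f φ) : Represents (fun x y => c * f x y) (c • φ) :=
  fun z => by simp only [map_smul, hf z, smul_eq_mul]

theorem sum {ι : Type*} {s : Finset ι} {f : ι → Coord N → Coord N → ℝ} {φ : ι → SmoothFun Ω}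
    (h : ∀ i, Represents (f i) (φ i)) :
    Represents (fun x y => ∑ i ∈ s, f i x y) (∑ i ∈ s, φ i) :=
  fun z => by
    rw [map_sum]
    exact Finset.sum_congr rfl fun i _ => h i z

theorem uncurry (h : Represents f φ) (z : Ω) : Function.uncurry f z = eval z φ :=
  h z

theorem hasFDerivAt (h : Represents f φ) (z : Ω) :
    HasFDerivAt (Function.uncurry f) (fderiv ℝ (Function.uncurry f) z) z :=
  ((contDiffOn_of_eq_eval h.uncurry).contDiffAt (Ω.isOpen.mem_nhds z.2)).differentiableAt (by simp)
    |>.hasFDerivAt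

theorem hasFDerivAt_fst (h : Represents f φ) (z : Ω) :
    HasFDerivAt (fun x => f x z.1.2) ((fderiv ℝ (Function.uncurry f) z).comp
      (.inl ℝ (Coord N) (Coord N))) z.1.1 :=
  (h.hasFDerivAt z).comp (f := fun x => (x, z.1.2)) z.1.1 (hasFDerivAt_prodMk_left z.1.1 z.1.2)

theorem hasFDerivAt_snd (h : Represents f φ) (z : Ω) :
    HasFDerivAt (f z.1.1) ((fderiv ℝ (Function.uncurry f) z).comp
      (.inr ℝ (Coord N) (Coord N))) z.1.2 :=
  (h.hasFDerivAt z).comp (f := fun y => (z.1.1, y)) z.1.2 (hasFDerivAt_prodMk_right z.1.1 z.1.2)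

theorem pdX (h : Represents f φ) (i : Fin N) : Represents (pdX f i) (derivX i φ) := fun z => by
  rw [derivX, eval_dirDeriv h.uncurry, FinslerAngle.pdX, pd, (h.hasFDerivAt_fst z).fderiv,
    ContinuousLinearMap.comp_apply, ContinuousLinearMap.inl_apply]

theorem pdY (h : Represents f φ) (i : Fin N) : Represents (pdY f i) (derivY i φ) := fun z => by
  rw [derivY, eval_dirDeriv h.uncurry, FinslerAngle.pdY, pd, (h.hasFDerivAt_snd z).fderiv,
    ContinuousLinearMap.comp_apply, ContinuousLinearMap.inr_apply]

theorem isUnit (h : Represents f φ) (hf : ∀ z ∈ Ω, f z.1 z.2 ≠ 0) : IsUnit φ :=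
  isUnit_of_eval_ne_zero fun z => by
    rw [← h z]
    exact hf z z.2

theorem const (r : ℝ) :
    Represents (fun _ _ => r) (algebraMap ℝ (SmoothFun Ω) r) := fun z =>
  ((eval z).commutes r).symm

theorem div (hf : Represents f φ) (hg : Represents g ψ) (hψ : IsUnit ψ) :
    Represents (fun x y => f x y / g x y) (φ * Ring.inverse ψ) := fun z => by
  have hinv : eval z (Ring.inverse ψ) * eval z ψ = 1 := by
    rw [← map_mul, Ring.inverse_mul_cancel _ hψ, map_one]
  beta_reduce
  rw [map_mul, eq_inv_of_mul_eq_one_left hinv, hf z, hg z, div_eq_mul_inv]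

theorem eq_of_eq (hf : Represents f φ) (hg : Represents g ψ) (h : φ = ψ) {x y : Coord N}
    (hxy : (x, y) ∈ Ω) : f x y = g x y :=
  (hf ⟨_, hxy⟩).trans ((congrArg _ h).trans (hg ⟨_, hxy⟩).symm)

theorem derivY_eq_zero {f : Coord N → ℝ} (h : Represents (fun x _ => f x) φ) (i : Fin N) :
    derivY i φ = 0 :=
  ext_eval fun z => by
    rw [← h.pdY i z, FinslerAngle.pdY, pd, fderiv_const_apply, map_zero]
    rfl

theorem euler (h : Represents f φ) {α : ℝ}
    (hf : ∀ z ∈ Ω, ∀ k : ℝ, 0 < k → f z.1 (k • z.2) = k ^ α * f z.1 z.2) :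
    ∑ i, derivY i φ * coordY i = α • φ :=
  ext_eval fun z => by
    rw [map_smul, ← h z, smul_eq_mul, ← fderiv_apply_self_of_homogeneous
      (h.hasFDerivAt_snd z).differentiableAt (hf z z.2), fderiv_eq_sum_pd, map_sum]
    refine Finset.sum_congr rfl fun i _ => ?_
    rw [map_mul, ← represents_coordY i z, ← h.pdY i z, FinslerAngle.pdY]

theorem derivY_rpow {α : ℝ} (h : Represents f φ) (hα : Represents (fun x y => f x y ^ α) ψ)
    (hf : ∀ z ∈ Ω, f z.1 z.2 ≠ 0) (i : Fin N) : φ * derivY i ψ = α • (ψ * derivY i φ) :=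
  ext_eval fun z => by
    have hpow := (h.hasFDerivAt_snd z).rpow_const (p := α) (Or.inl (hf z z.2))
    have hderiv : eval z (derivY i ψ) = α * f z.1.1 z.1.2 ^ (α - 1) * eval z (derivY i φ) := by
      rw [← hα.pdY i z, ← h.pdY i z, FinslerAngle.pdY, pd, hpow.fderiv, FinslerAngle.pdY, pd,
        (h.hasFDerivAt_snd z).fderiv, smul_apply, smul_eq_mul]
    rw [map_mul, map_smul, map_mul, hderiv, ← h z, ← hα z, Real.rpow_sub_one (hf z z.2),
      smul_eq_mul]
    field_simp [hf z z.2]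

variable {B : Coord N → Coord N → Matrix (Fin N) (Fin N) ℝ}
  {b : Matrix (Fin N) (Fin N) (SmoothFun Ω)}

theorem map_eval (h : ∀ i j, Represents (fun x y => B x y i j) (b i j)) (z : Ω) :
    b.map (eval z) = B z.1.1 z.1.2 :=
  Matrix.ext fun i j => (h i j z).symm

theorem isUnit_det (h : ∀ i j, Represents (fun x y => B x y i j) (b i j))
    (hB : ∀ z ∈ Ω, (B z.1 z.2).det ≠ 0) : IsUnit b.det :=
  isUnit_det_of_eval fun z => by
    rw [map_eval h]
    exact hB z z.2

theorem matrix_inv (h : ∀ i j, Represents (fun x y => B x y i j) (b i j)) (hb : IsUnit b.det)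
    (i j : Fin N) : Represents (fun x y => (B x y)⁻¹ i j) (b⁻¹ i j) := fun z => by
  beta_reduce
  rw [← map_eval h, ← map_eval_inv hb, Matrix.map_apply]

end Represents

theorem derivY_comp_coordY (k : Fin N) :
    derivY k ∘ (coordY : Fin N → SmoothFun Ω) = Pi.single k 1 :=
  funext fun i => ext_eval fun z => by
    rw [Function.comp_apply, ← (represents_coordY i).pdY k z, pdY, pd, fderiv_apply (by fun_prop)]
    simp [Pi.single_apply, apply_ite (eval z)]

end Represents

end FinslerAngle

/-! ### Connections along derivations -/

namespace FinslerAngle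

open Matrix

variable {𝕜 R : Type*} [CommRing 𝕜] [CommRing R] [Algebra 𝕜 R] {ι n : Type*}

section MatrixDerivation

theorem map_derivation_vecMulVec (D : Derivation 𝕜 R R) (u v : n → R) :
    (vecMulVec u v).map D = vecMulVec (D ∘ u) v + vecMulVec u (D ∘ v) := by
  ext i j
  simp [vecMulVec_apply, mul_comm, add_comm]

theorem map_derivation_smul (D : Derivation 𝕜 R R) (c : R) (A : Matrix n n R) :
    (c • A).map D = c • A.map D + D c • A := by
  ext i j
  simp [mul_comm]

theorem map_derivation_comm {D E : Derivation 𝕜 R R} (h : ∀ φ, D (E φ) = E (D φ))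
    (A : Matrix n n R) : (A.map E).map D = (A.map D).map E := by
  ext i j
  exact h _

theorem derivation_comp_neg (D : Derivation 𝕜 R R) (v : n → R) : D ∘ (-v) = -(D ∘ v) :=
  funext fun _ => map_neg _ _

variable [Fintype n]

theorem map_derivation_mul (D : Derivation 𝕜 R R) (A B : Matrix n n R) :
    (A * B).map D = A.map D * B + A * B.map D := by
  ext i j
  simp [Matrix.mul_apply, map_sum, Finset.sum_add_distrib, mul_comm, add_comm]

theorem derivation_comp_mulVec (D : Derivation 𝕜 R R) (A : Matrix n n R) (v : n → R) :
    D ∘ (A *ᵥ v) = A.map D *ᵥ v + A *ᵥ (D ∘ v) := by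
  ext i
  simp [mulVec, dotProduct, map_sum, Finset.sum_add_distrib, mul_comm, add_comm]

theorem derivation_dotProduct (D : Derivation 𝕜 R R) (u v : n → R) :
    D (u ⬝ᵥ v) = (D ∘ u) ⬝ᵥ v + u ⬝ᵥ (D ∘ v) := by
  simp [dotProduct, map_sum, Finset.sum_add_distrib, mul_comm, add_comm]

theorem map_derivation_inv [DecidableEq n] (D : Derivation 𝕜 R R) {A : Matrix n n R}
    (hA : IsUnit A.det) : A⁻¹.map D = -(A⁻¹ * A.map D * A⁻¹) := by
  have hone : (1 : Matrix n n R).map D = 0 := by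
    ext i j
    rw [map_apply, one_apply]
    split_ifs <;> simp
  have h : A⁻¹.map D * A = -(A⁻¹ * A.map D) := by
    rw [eq_neg_iff_add_eq_zero, ← map_derivation_mul, nonsing_inv_mul _ hA, hone]
  rw [← mul_nonsing_inv_cancel_right _ (A⁻¹.map D) hA, h, Matrix.neg_mul]

end MatrixDerivation

section Connection

variable [Fintype n]

/-- The covariant derivative `X_l v + G_l v` of a vector field `v` with respect to the connection
matrices `G_l = (G^i_{lk})_{ik}` along the derivations `X_l`. -/
def covDerivVec (X : ι → Derivation 𝕜 R R) (G : ι → Matrix n n R) (l : ι) (v : n → R) : n → R :=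
  X l ∘ v + G l *ᵥ v

/-- The covariant derivative `X_l B + [G_l, B]` of a field `B` of endomorphisms. -/
def covDeriv (X : ι → Derivation 𝕜 R R) (G : ι → Matrix n n R) (l : ι) (B : Matrix n n R) :
    Matrix n n R :=
  B.map (X l) + G l * B - B * G l

/-- The curvature `X_i G_j - X_j G_i + [G_i, G_j]` of the connection matrices `G_i`. The derivations
`X_i` need not commute; this is then the curvature up to the term along `[X_i, X_j]`. -/
def curvature (X : ι → Derivation 𝕜 R R) (G : ι → Matrix n n R) (i j : ι) : Matrix n n R :=
  (G j).map (X i) - (G i).map (X j) + G i * G j - G j * G i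

/-- The connection `G` is compatible with the bilinear form `a`. -/
def IsMetricConnection (X : ι → Derivation 𝕜 R R) (G : ι → Matrix n n R) (a : Matrix n n R) :
    Prop :=
  ∀ l, a.map (X l) = (G l)ᵀ * a + a * G l

variable {X : ι → Derivation 𝕜 R R} {G G' : ι → Matrix n n R} {a T : Matrix n n R}

theorem curvature_swap (i j : ι) : curvature X G j i = -curvature X G i j := by
  unfold curvature
  abel

theorem curvature_bianchi (hX : ∀ i j φ, X i (X j φ) = X j (X i φ)) (l i j : ι) :
    covDeriv X G l (curvature X G i j) + covDeriv X G j (curvature X G l i)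
      + covDeriv X G i (curvature X G j l) = 0 := by
  have hadd (l : ι) (A B : Matrix n n R) : (A + B).map (X l) = A.map (X l) + B.map (X l) :=
    Matrix.map_add _ (map_add _) A B
  have hsub (l : ι) (A B : Matrix n n R) : (A - B).map (X l) = A.map (X l) - B.map (X l) :=
    Matrix.map_sub _ (map_sub _) A B
  simp only [covDeriv, curvature, hadd, hsub, map_derivation_mul]
  rw [map_derivation_comm (hX l j), map_derivation_comm (hX i j), map_derivation_comm (hX i l)]
  noncomm_ring

theorem IsMetricConnection.derivation_dotProduct_mulVec (ha : IsMetricConnection X G a) (l : ι)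
    (u v : n → R) : X l (u ⬝ᵥ (a *ᵥ v)) =
      covDerivVec X G l u ⬝ᵥ (a *ᵥ v) + u ⬝ᵥ (a *ᵥ covDerivVec X G l v) := by
  rw [derivation_dotProduct, derivation_comp_mulVec, ha l, covDerivVec, covDerivVec, add_mulVec,
    mulVec_add, dotProduct_add, dotProduct_add, dotProduct_add, add_dotProduct, ← mulVec_mulVec,
    ← mulVec_mulVec, dotProduct_transpose_mulVec, dotProduct_comm (a *ᵥ v)]
  abel

theorem IsMetricConnection.isSkewAdjoint_curvature (ha : IsMetricConnection X G a)
    (hX : ∀ i j φ, X i (X j φ) = X j (X i φ)) (i j : ι) :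
    a.IsSkewAdjoint (curvature X G i j) := by
  have hsecond (i j : ι) : (a.map (X j)).map (X i) =
      ((G j).map (X i))ᵀ * a + (G j)ᵀ * ((G i)ᵀ * a + a * G i)
        + (((G i)ᵀ * a + a * G i) * G j + a * (G j).map (X i)) := by
    rw [ha j, Matrix.map_add _ (map_add _), map_derivation_mul, map_derivation_mul, ha i,
      ← transpose_map]
  have h := map_derivation_comm (hX i j) a
  rw [hsecond, hsecond, ← sub_eq_zero] at h
  simp only [Matrix.IsSkewAdjoint, Matrix.IsAdjointPair, curvature, transpose_add, transpose_sub,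
    transpose_mul]
  rw [← sub_eq_zero, ← h]
  noncomm_ring

theorem covDerivVec_mulVec {v : n → R} (B : Matrix n n R) (l : ι)
    (hv : covDerivVec X G l v = 0) : covDerivVec X G l (B *ᵥ v) = covDeriv X G l B *ᵥ v := by
  have hv' : X l ∘ v = -(G l *ᵥ v) := eq_neg_of_add_eq_zero_left hv
  rw [covDerivVec, covDeriv, derivation_comp_mulVec, hv', sub_mulVec, add_mulVec, mulVec_neg,
    mulVec_mulVec, mulVec_mulVec]
  abel

variable [DecidableEq n]

theorem map_derivation_inv_of_intertwines (hT : IsUnit T.det) {l : ι}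
    (hl : T.map (X l) = T * G' l - G l * T) : T⁻¹.map (X l) = T⁻¹ * G l - G' l * T⁻¹ := by
  rw [map_derivation_inv _ hT, hl, Matrix.mul_sub, Matrix.sub_mul,
    nonsing_inv_mul_cancel_left _ _ hT, Matrix.mul_assoc, mul_nonsing_inv_cancel_right _ _ hT]
  abel

theorem covDerivVec_inv_mulVec (hT : IsUnit T.det) {l : ι}
    (hl : T.map (X l) = T * G' l - G l * T) (v : n → R) :
    covDerivVec X G' l (T⁻¹ *ᵥ v) = T⁻¹ *ᵥ covDerivVec X G l v := by
  rw [covDerivVec, covDerivVec, derivation_comp_mulVec,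
    map_derivation_inv_of_intertwines hT hl, sub_mulVec, mulVec_add, mulVec_mulVec,
    mulVec_mulVec]
  abel

theorem covDeriv_conj (hT : IsUnit T.det) {l : ι} (hl : T.map (X l) = T * G' l - G l * T)
    (B : Matrix n n R) : covDeriv X G' l (T⁻¹ * B * T) = T⁻¹ * covDeriv X G l B * T := by
  rw [covDeriv, covDeriv, map_derivation_mul, map_derivation_mul,
    map_derivation_inv_of_intertwines hT hl, hl]
  noncomm_ring

end Connection

theorem cyclic_sum_connection_smul_eq_zero [Fintype n] {W : Type*} [AddCommGroup W] [Module R W]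
    {G : n → Matrix n n R} (hG : ∀ l i k, G l i k = G k i l) {B : n → n → W}
    (hB : ∀ i j, B j i = -B i j) (l i j : n) :
    (∑ s, G i s l • B s j + ∑ s, G j s l • B i s)
      + (∑ s, G l s j • B s i + ∑ s, G i s j • B l s)
      + (∑ s, G j s i • B s l + ∑ s, G l s i • B j s) = 0 := by
  have hpair (i j l : n) : ∑ s, G i s l • B s j = -∑ s, G l s i • B j s := by
    rw [← Finset.sum_neg_distrib]
    exact Finset.sum_congr rfl fun s _ => by rw [hB j s, smul_neg, hG l s i]
  rw [hpair i j l, hpair l i j, hpair j l i]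
  abel

section Christoffel

variable [Invertible (2 : 𝕜)] [Fintype n] [DecidableEq n]

/-- The matrices `(Γ^i_{lk})_{ik}` of Christoffel symbols of the second kind of the metric `a`. -/
noncomputable def christoffelMatrix (X : n → Derivation 𝕜 R R) (a : Matrix n n R) (l : n) :
    Matrix n n R :=
  a⁻¹ * of fun m k => ⅟(2 : 𝕜) • (X l (a m k) + X k (a m l) - X m (a k l))

variable {X : n → Derivation 𝕜 R R} {a : Matrix n n R}

theorem christoffelMatrix_symm (ha : a.IsSymm) (l i k : n) :
    christoffelMatrix X a l i k = christoffelMatrix X a k i l := by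
  simp only [christoffelMatrix, Matrix.mul_apply, of_apply]
  refine Finset.sum_congr rfl fun m _ => ?_
  rw [ha.apply l k, add_comm (X l (a m k))]

theorem isMetricConnection_christoffelMatrix (ha : a.IsSymm) (hu : IsUnit a.det) :
    IsMetricConnection X (christoffelMatrix X a) a := fun l => by
  have hlow : (christoffelMatrix X a l)ᵀ * a = (a * christoffelMatrix X a l)ᵀ := by
    rw [transpose_mul, ha.eq]
  rw [hlow, christoffelMatrix, mul_nonsing_inv_cancel_left _ _ hu]
  ext i j
  simp only [map_apply, Matrix.add_apply, transpose_apply, of_apply]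
  rw [ha.apply i j, ← smul_add, eq_comm, invOf_smul_eq_iff, ofNat_smul_eq_nsmul, two_nsmul]
  abel

end Christoffel

end FinslerAngle

/-! ### Horizontal lifts -/

namespace FinslerAngle

open Matrix

variable {𝕜 R : Type*} [CommRing 𝕜] [CommRing R] [Algebra 𝕜 R] {ι κ n : Type*}

/-- The derivations `X_i` and `V_k` all commute with each other, like the coordinate derivations
`∂/∂x^i` and `∂/∂y^k`. -/
structure CommutingFrames (X : ι → Derivation 𝕜 R R) (V : κ → Derivation 𝕜 R R) : Prop where
  base_comm : ∀ i j φ, X i (X j φ) = X j (X i φ)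
  mixed_comm : ∀ i k φ, X i (V k φ) = V k (X i φ)
  vertical_comm : ∀ k m φ, V k (V m φ) = V m (V k φ)

theorem vertical_curvature [Fintype n] {X : ι → Derivation 𝕜 R R} {V : κ → Derivation 𝕜 R R}
    {Γ : ι → Matrix n n R} (hXV : ∀ i k φ, X i (V k φ) = V k (X i φ))
    (hΓ : ∀ k l a b, V k (Γ l a b) = 0) (k : κ) (i j : ι) (a b : n) :
    V k (curvature X Γ i j a b) = 0 := by
  simp [curvature, Matrix.mul_apply, ← hXV, hΓ]

section HorizontalLift

variable [Fintype κ]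

/-- The horizontal lift `X_i + c^k_i V_k` of `X_i`, for coefficients `c` of a nonlinear connection
and vertical derivations `V_k`. -/
def horizontal (X : ι → Derivation 𝕜 R R) (V : κ → Derivation 𝕜 R R) (c : ι → κ → R) (i : ι) :
    Derivation 𝕜 R R :=
  X i + ∑ k, c i k • V k

/-- The matrices `(-∂c^m_i/∂y^k)_{mk}` of the linear connection on vertical vectors which is induced
by the nonlinear connection `c`. -/
def verticalConnection (V : κ → Derivation 𝕜 R R) (c : ι → κ → R) (i : ι) : Matrix κ κ R :=
  of fun m k => -V k (c i m)

/-- The curvature `d_i c_j - d_j c_i` of the nonlinear connection `c`, where `d` is the horizontal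
lift. -/
def nonlinearCurvature (X : ι → Derivation 𝕜 R R) (V : κ → Derivation 𝕜 R R) (c : ι → κ → R)
    (i j : ι) : κ → R :=
  horizontal X V c i ∘ c j - horizontal X V c j ∘ c i

variable {X : ι → Derivation 𝕜 R R} {V : κ → Derivation 𝕜 R R} {c : ι → κ → R}

theorem horizontal_apply (i : ι) (φ : R) :
    horizontal X V c i φ = X i φ + ∑ k, c i k * V k φ := by
  simp only [horizontal, Derivation.add_apply, ← Derivation.coeFnAddMonoidHom_apply, map_sum,
    Finset.sum_apply]
  simp [Derivation.coeFnAddMonoidHom_apply]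

theorem horizontal_eq_of_vertical_eq_zero {φ : R} (h : ∀ k, V k φ = 0) (i : ι) :
    horizontal X V c i φ = X i φ := by
  simp [horizontal_apply, h]

theorem nonlinearCurvature_swap (i j : ι) :
    nonlinearCurvature X V c j i = -nonlinearCurvature X V c i j :=
  (neg_sub _ _).symm

theorem horizontal_vertical (hXV : CommutingFrames X V) (i : ι) (k : κ) (φ : R) :
    horizontal X V c i (V k φ) =
      V k (horizontal X V c i φ) + ∑ m, verticalConnection V c i m k * V m φ := by
  simp only [horizontal_apply, map_add, map_sum, Derivation.leibniz, smul_eq_mul,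
    verticalConnection, of_apply, hXV.mixed_comm, Finset.sum_add_distrib, neg_mul,
    Finset.sum_neg_distrib, hXV.vertical_comm k]
  simp only [mul_comm]
  abel

theorem horizontal_horizontal (hXV : ∀ i k φ, X i (V k φ) = V k (X i φ)) (i j : ι) (φ : R) :
    horizontal X V c i (horizontal X V c j φ) =
      X i (X j φ) + ∑ k, c i k * X j (V k φ) + ∑ k, c j k * X i (V k φ)
        + ∑ k, horizontal X V c i (c j k) * V k φ
        + ∑ k, ∑ l, c j k * (c i l * V l (V k φ)) := by
  rw [horizontal_apply j, map_add, map_sum]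
  simp only [Derivation.leibniz, smul_eq_mul, Finset.sum_add_distrib]
  rw [horizontal_apply i (X j φ)]
  simp only [horizontal_apply i (V _ φ), mul_add, Finset.sum_add_distrib, Finset.mul_sum, hXV j,
    mul_comm (V _ φ)]
  abel

theorem horizontal_comm (hXV : CommutingFrames X V) (i j : ι) (φ : R) :
    horizontal X V c i (horizontal X V c j φ) - horizontal X V c j (horizontal X V c i φ) =
      ∑ k, nonlinearCurvature X V c i j k * V k φ := by
  have hVV : ∑ k, ∑ l, c j k * (c i l * V l (V k φ)) = ∑ k, ∑ l, c i k * (c j l * V l (V k φ)) := by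
    rw [Finset.sum_comm]
    refine Finset.sum_congr rfl fun l _ => Finset.sum_congr rfl fun k _ => ?_
    rw [hXV.vertical_comm l k, mul_left_comm]
  rw [horizontal_horizontal hXV.mixed_comm, horizontal_horizontal hXV.mixed_comm,
    hXV.base_comm i j, hVV]
  simp only [nonlinearCurvature, Pi.sub_apply, Function.comp_apply, sub_mul, Finset.sum_sub_distrib]
  abel

theorem curvature_verticalConnection (hXV : CommutingFrames X V) (i j : ι) (m k : κ) :
    curvature (horizontal X V c) (verticalConnection V c) i j m k =
      -V k (nonlinearCurvature X V c i j m) := by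
  have h (i j : ι) : horizontal X V c i (verticalConnection V c j m k) =
      -V k (horizontal X V c i (c j m)) +
        (verticalConnection V c j * verticalConnection V c i) m k := by
    rw [Matrix.mul_apply, verticalConnection, of_apply, map_neg, horizontal_vertical hXV,
      neg_add, ← Finset.sum_neg_distrib]
    congr 1
    exact Finset.sum_congr rfl fun s _ => by rw [of_apply, neg_mul, mul_comm]
  simp only [curvature, Matrix.sub_apply, Matrix.add_apply, Matrix.map_apply, h,
    nonlinearCurvature, Pi.sub_apply, Function.comp_apply, map_sub]
  ring

variable [Fintype n]

theorem curvature_horizontal {Γ : ι → Matrix n n R} (hΓ : ∀ k l a b, V k (Γ l a b) = 0) (i j : ι) :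
    curvature (horizontal X V c) Γ i j = curvature X Γ i j := by
  have h (i l : ι) : (Γ l).map (horizontal X V c i) = (Γ l).map (X i) :=
    Matrix.ext fun a b => horizontal_eq_of_vertical_eq_zero (fun k => hΓ k l a b) i
  rw [curvature, curvature, h, h]

theorem covDeriv_horizontal {Γ : ι → Matrix n n R} {B : Matrix n n R}
    (hB : ∀ k a b, V k (B a b) = 0) (l : ι) :
    covDeriv (horizontal X V c) Γ l B = covDeriv X Γ l B := by
  have h : B.map (horizontal X V c l) = B.map (X l) :=
    Matrix.ext fun a b => horizontal_eq_of_vertical_eq_zero (fun k => hB k a b) l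
  rw [covDeriv, covDeriv, h]

theorem IsMetricConnection.horizontal {Γ : ι → Matrix n n R} {a : Matrix n n R}
    (h : IsMetricConnection X Γ a) (ha : ∀ k m n, V k (a m n) = 0) :
    IsMetricConnection (horizontal X V c) Γ a := fun l => by
  rw [← h l]
  exact Matrix.ext fun m n => horizontal_eq_of_vertical_eq_zero (fun k => ha k m n) l

end HorizontalLift

section HorizontalMap

variable [Fintype n] {X : ι → Derivation 𝕜 R R} {V : n → Derivation 𝕜 R R} {c : ι → n → R}
  {Γ : ι → Matrix n n R} {t : n → R}

/-- The Jacobian matrix `(∂t^m/∂y^k)_{mk}` of `t` along the vertical derivations. -/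
def fibreJacobian (V : n → Derivation 𝕜 R R) (t : n → R) : Matrix n n R :=
  of fun m k => V k (t m)

theorem covDerivVec_horizontal_eq_zero [DecidableEq n] (hT : IsUnit (fibreJacobian V t).det)
    (hc : ∀ i, c i = -((fibreJacobian V t)⁻¹ *ᵥ covDerivVec X Γ i t)) (i : ι) :
    covDerivVec (horizontal X V c) Γ i t = 0 := by
  have hd : horizontal X V c i ∘ t = X i ∘ t + fibreJacobian V t *ᵥ c i := by
    funext m
    simp only [Function.comp_apply, horizontal_apply, Pi.add_apply, mulVec, dotProduct,
      fibreJacobian, of_apply, mul_comm]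
  rw [covDerivVec, hd, hc, mulVec_neg, mulVec_mulVec, mul_nonsing_inv _ hT, one_mulVec, covDerivVec]
  abel

theorem fibreJacobian_map_horizontal (hXV : CommutingFrames X V)
    (hΓ : ∀ k l a b, V k (Γ l a b) = 0) {l : ι}
    (ht : covDerivVec (horizontal X V c) Γ l t = 0) :
    (fibreJacobian V t).map (horizontal X V c l) =
      fibreJacobian V t * verticalConnection V c l - Γ l * fibreJacobian V t := by
  ext1 h k
  have hd : horizontal X V c l (t h) = -(Γ l *ᵥ t) h :=
    congrFun (eq_neg_of_add_eq_zero_left ht) h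
  simp only [map_apply, fibreJacobian, of_apply, horizontal_vertical hXV, hd, Matrix.sub_apply,
    Matrix.mul_apply, map_neg, mulVec, dotProduct, map_sum, Derivation.leibniz, hΓ, smul_eq_mul,
    mul_zero, add_zero]
  simp only [mul_comm]
  abel

/-- Compare the two sides of `[d_i, d_j] t = M^k_{ij} ∂t/∂y^k`: the left one is `-R_{ij} t`. -/
theorem fibreJacobian_mulVec_nonlinearCurvature (hXV : CommutingFrames X V)
    (hΓ : ∀ k l a b, V k (Γ l a b) = 0) (ht : ∀ l, covDerivVec (horizontal X V c) Γ l t = 0)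
    (i j : ι) :
    fibreJacobian V t *ᵥ nonlinearCurvature X V c i j = -(curvature X Γ i j *ᵥ t) := by
  have hcomm : fibreJacobian V t *ᵥ nonlinearCurvature X V c i j =
      horizontal X V c i ∘ (horizontal X V c j ∘ t)
        - horizontal X V c j ∘ (horizontal X V c i ∘ t) := by
    funext m
    simp only [Pi.sub_apply, Function.comp_apply, horizontal_comm hXV, mulVec, dotProduct,
      fibreJacobian, of_apply, mul_comm]
  have hd (l : ι) : horizontal X V c l ∘ t = -(Γ l *ᵥ t) := eq_neg_of_add_eq_zero_left (ht l)
  rw [hcomm, hd, hd, derivation_comp_neg, derivation_comp_neg, derivation_comp_mulVec,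
    derivation_comp_mulVec, hd, hd, ← curvature_horizontal (X := X) (c := c) hΓ, curvature]
  simp only [mulVec_neg, mulVec_mulVec, sub_mulVec, add_mulVec]
  abel

theorem nonlinearCurvature_eq [DecidableEq n] (hXV : CommutingFrames X V)
    (hΓ : ∀ k l a b, V k (Γ l a b) = 0) (ht : ∀ l, covDerivVec (horizontal X V c) Γ l t = 0)
    (hT : IsUnit (fibreJacobian V t).det) (i j : ι) :
    nonlinearCurvature X V c i j = -((fibreJacobian V t)⁻¹ *ᵥ (curvature X Γ i j *ᵥ t)) := by
  rw [← mulVec_neg, ← fibreJacobian_mulVec_nonlinearCurvature hXV hΓ ht, mulVec_mulVec,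
    nonsing_inv_mul _ hT, one_mulVec]

/-- The fibre derivative of `T M_{ij} = -R_{ij} t`. -/
theorem fibreJacobian_mul_curvature_verticalConnection (hXV : CommutingFrames X V)
    (hΓ : ∀ k l a b, V k (Γ l a b) = 0) (ht : ∀ l, covDerivVec (horizontal X V c) Γ l t = 0)
    (i j : ι) (h k : n) :
    (fibreJacobian V t * curvature (horizontal X V c) (verticalConnection V c) i j) h k =
      ((fibreJacobian V t).map (V k) *ᵥ nonlinearCurvature X V c i j) h
        + (curvature X Γ i j * fibreJacobian V t) h k := by
  have hR : (curvature X Γ i j).map (V k) = 0 :=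
    Matrix.ext fun a b => vertical_curvature hXV.mixed_comm hΓ k i j a b
  have hVM := congrArg (fun v => (V k ∘ v) h)
    (fibreJacobian_mulVec_nonlinearCurvature hXV hΓ ht i j)
  simp only [derivation_comp_neg, derivation_comp_mulVec, hR, zero_mulVec, zero_add, Pi.add_apply,
    Pi.neg_apply] at hVM
  have hE : (fibreJacobian V t * curvature (horizontal X V c) (verticalConnection V c) i j) h k =
      -(fibreJacobian V t *ᵥ (V k ∘ nonlinearCurvature X V c i j)) h := by
    simp only [Matrix.mul_apply, mulVec, dotProduct, curvature_verticalConnection hXV, mul_neg,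
      Finset.sum_neg_distrib, Function.comp_apply]
  have hRT : (curvature X Γ i j * fibreJacobian V t) h k = (curvature X Γ i j *ᵥ (V k ∘ t)) h := rfl
  rw [hE, hRT]
  linear_combination -hVM

end HorizontalMap

end FinslerAngle

/-! ### Skew-adjoint endomorphisms and bivectors -/

namespace FinslerAngle

open Matrix

variable {𝕜 R : Type*} [CommRing 𝕜] [CommRing R] [Algebra 𝕜 R] {ι n : Type*} [Fintype n]

section SkewAdjoint

variable {a B Q : Matrix n n R}

theorem dotProduct_mulVec_of_isSkewAdjoint (hB : a.IsSkewAdjoint B) (u v : n → R) :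
    u ⬝ᵥ (a *ᵥ (B *ᵥ v)) = -((B *ᵥ u) ⬝ᵥ (a *ᵥ v)) := by
  have hBa : a * B = -(Bᵀ * a) := by
    rw [show Bᵀ * a = a * -B from hB, Matrix.mul_neg, neg_neg]
  rw [mulVec_mulVec, hBa, neg_mulVec, dotProduct_neg, ← mulVec_mulVec, dotProduct_transpose_mulVec,
    dotProduct_comm]

theorem dotProduct_mulVec_comm_of_isSymm (ha : a.IsSymm) (u v : n → R) :
    u ⬝ᵥ (a *ᵥ v) = v ⬝ᵥ (a *ᵥ u) := by
  rw [← dotProduct_transpose_mulVec, ha.eq]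

theorem dotProduct_mulVec_self_of_isSkewAdjoint [IsAddTorsionFree R] (ha : a.IsSymm)
    (hB : a.IsSkewAdjoint B) (v : n → R) : v ⬝ᵥ (a *ᵥ (B *ᵥ v)) = 0 := by
  rw [← neg_eq_self, dotProduct_mulVec_comm_of_isSymm ha, ← dotProduct_mulVec_of_isSkewAdjoint hB,
    dotProduct_mulVec_comm_of_isSymm ha]

theorem isSymm_transpose_mul_mul (ha : a.IsSymm) (T : Matrix n n R) : (Tᵀ * a * T).IsSymm := by
  rw [Matrix.IsSymm, transpose_mul, transpose_mul, transpose_transpose, ha.eq, Matrix.mul_assoc]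

theorem trace_raise_mul_lower [DecidableEq n] (hu : IsUnit a.det) (hQ : a.IsSkewAdjoint Q)
    (P : Matrix n n R) : (P * a⁻¹ * (Qᵀ * a)).trace = -(P * Q).trace := by
  rw [show Qᵀ * a = a * -Q from hQ, Matrix.mul_assoc, nonsing_inv_mul_cancel_left _ _ hu,
    Matrix.mul_neg, trace_neg]

end SkewAdjoint

section Wedge

/-- The endomorphism `u ⊗ a(v, ·) - v ⊗ a(u, ·)` attached to the bivector `u ∧ v` by a symmetric
form `a`. -/
def wedge (a : Matrix n n R) (u v : n → R) : Matrix n n R :=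
  vecMulVec u (a *ᵥ v) - vecMulVec v (a *ᵥ u)

variable {a P T : Matrix n n R}

theorem wedge_zero_right (a : Matrix n n R) (u : n → R) : wedge a u 0 = 0 := by
  ext
  simp [wedge]

theorem wedge_smul_form (c : R) (a : Matrix n n R) (u v : n → R) :
    wedge (c • a) u v = c • wedge a u v := by
  simp only [wedge, smul_mulVec, vecMulVec_smul, smul_sub]

theorem wedge_smul_right (c : R) (a : Matrix n n R) (u v : n → R) :
    wedge a u (c • v) = c • wedge a u v := by
  simp only [wedge, mulVec_smul, vecMulVec_smul, smul_vecMulVec, smul_sub]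

theorem wedge_smul_left (c : R) (a : Matrix n n R) (u v : n → R) :
    wedge a (c • u) v = c • wedge a u v := by
  simp only [wedge, mulVec_smul, vecMulVec_smul, smul_vecMulVec, smul_sub]

theorem wedge_add_left (a : Matrix n n R) (u u' v : n → R) :
    wedge a (u + u') v = wedge a u v + wedge a u' v := by
  simp only [wedge, mulVec_add, vecMulVec_add, add_vecMulVec]
  abel

theorem isSkewAdjoint_wedge (ha : a.IsSymm) (u v : n → R) : a.IsSkewAdjoint (wedge a u v) := by
  simp only [Matrix.IsSkewAdjoint, Matrix.IsAdjointPair, wedge, transpose_sub, transpose_vecMulVec,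
    Matrix.sub_mul, neg_sub, Matrix.mul_sub, vecMulVec_mul, mul_vecMulVec]
  rw [← mulVec_transpose, ← mulVec_transpose, ha.eq]

theorem inv_mul_wedge_mul [DecidableEq n] (hT : IsUnit T.det) (a : Matrix n n R) (u v : n → R) :
    T⁻¹ * wedge a u v * T = wedge (Tᵀ * a * T) (T⁻¹ *ᵥ u) (T⁻¹ *ᵥ v) := by
  have hlow (w : n → R) : (Tᵀ * a * T) *ᵥ (T⁻¹ *ᵥ w) = (a *ᵥ w) ᵥ* T := by
    rw [mulVec_mulVec, mul_nonsing_inv_cancel_right _ _ hT, ← mulVec_mulVec, mulVec_transpose]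
  simp only [wedge, hlow, Matrix.mul_sub, Matrix.sub_mul, mul_vecMulVec, vecMulVec_mul]

theorem trace_mul_wedge (ha : a.IsSymm) (hP : a.IsSkewAdjoint P) (u v : n → R) :
    (P * wedge a u v).trace = -2 * ((P *ᵥ v) ⬝ᵥ (a *ᵥ u)) := by
  have h (u v : n → R) : (P * vecMulVec u (a *ᵥ v)).trace = (P *ᵥ u) ⬝ᵥ (a *ᵥ v) := by
    rw [mul_vecMulVec, trace_vecMulVec]
  rw [wedge, Matrix.mul_sub, trace_sub, h, h, dotProduct_mulVec_comm_of_isSymm ha,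
    dotProduct_mulVec_of_isSkewAdjoint hP]
  ring

theorem wedge_mulVec (a : Matrix n n R) (u v w : n → R) :
    wedge a u v *ᵥ w = ((a *ᵥ v) ⬝ᵥ w) • u - ((a *ᵥ u) ⬝ᵥ w) • v := by
  rw [wedge, sub_mulVec, vecMulVec_mulVec, vecMulVec_mulVec, op_smul_eq_smul, op_smul_eq_smul]

theorem covDeriv_wedge {X : ι → Derivation 𝕜 R R} {G : ι → Matrix n n R}
    (ha : IsMetricConnection X G a) (l : ι) (u v : n → R) :
    covDeriv X G l (wedge a u v) =
      wedge a (covDerivVec X G l u) v + wedge a u (covDerivVec X G l v) := by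
  have hlow (w : n → R) : X l ∘ (a *ᵥ w) = a *ᵥ covDerivVec X G l w + (a *ᵥ w) ᵥ* G l := by
    rw [derivation_comp_mulVec, ha l, covDerivVec, add_mulVec, mulVec_add, ← mulVec_mulVec,
      mulVec_transpose, mulVec_mulVec]
    abel
  have htensor (u v : n → R) : covDeriv X G l (vecMulVec u (a *ᵥ v)) =
      vecMulVec (covDerivVec X G l u) (a *ᵥ v) + vecMulVec u (a *ᵥ covDerivVec X G l v) := by
    have hu : covDerivVec X G l u = X l ∘ u + G l *ᵥ u := rfl
    rw [covDeriv, map_derivation_vecMulVec, hlow, mul_vecMulVec, vecMulVec_mul, hu, add_vecMulVec,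
      vecMulVec_add]
    abel
  have hsub (A B : Matrix n n R) :
      covDeriv X G l (A - B) = covDeriv X G l A - covDeriv X G l B := by
    rw [covDeriv, Matrix.map_sub _ (map_sub _), covDeriv, covDeriv, Matrix.mul_sub, Matrix.sub_mul]
    abel
  rw [wedge, hsub, htensor, htensor, wedge, wedge]
  abel

end Wedge

section Twist

/-- The map `B ↦ B + μ (B t ∧ t)` on endomorphisms. For a suitable `μ`, conjugation by the fibre
Jacobian `T` turns it into the passage from the Riemannian curvature to `ρ`. -/
def twist (a : Matrix n n R) (t : n → R) (μ : R) : Matrix n n R →ₗ[R] Matrix n n R where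
  toFun B := B + μ • wedge a (B *ᵥ t) t
  map_add' A B := by
    rw [add_mulVec, wedge_add_left, smul_add]
    abel
  map_smul' c B := by
    rw [smul_mulVec, wedge_smul_left, RingHom.id_apply, smul_add, smul_comm]

variable {a P Q : Matrix n n R} {t : n → R}

theorem twist_apply (a : Matrix n n R) (t : n → R) (μ : R) (B : Matrix n n R) :
    twist a t μ B = B + μ • wedge a (B *ᵥ t) t :=
  rfl

theorem isSkewAdjoint_twist (ha : a.IsSymm) (hP : a.IsSkewAdjoint P) (t : n → R) (μ : R) :
    a.IsSkewAdjoint (twist a t μ P) := by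
  classical
  have hw := isSkewAdjoint_wedge ha (P *ᵥ t) t
  rw [← mem_skewAdjointMatricesSubmodule] at hP hw ⊢
  exact add_mem hP (Submodule.smul_mem _ μ hw)

theorem covDeriv_twist {X : ι → Derivation 𝕜 R R} {G : ι → Matrix n n R} {μ : R} {l : ι}
    (ha : IsMetricConnection X G a) (ht : covDerivVec X G l t = 0) (hμ : X l μ = 0)
    (B : Matrix n n R) :
    covDeriv X G l (twist a t μ B) = twist a t μ (covDeriv X G l B) := by
  have hsmul (A : Matrix n n R) : covDeriv X G l (μ • A) = μ • covDeriv X G l A := by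
    rw [covDeriv, map_derivation_smul, hμ, zero_smul, add_zero, covDeriv, Matrix.mul_smul,
      Matrix.smul_mul, smul_sub, smul_add]
  have hadd (A B : Matrix n n R) :
      covDeriv X G l (A + B) = covDeriv X G l A + covDeriv X G l B := by
    rw [covDeriv, Matrix.map_add _ (map_add _), covDeriv, covDeriv, Matrix.mul_add, Matrix.add_mul]
    abel
  rw [twist_apply, hadd, hsmul, covDeriv_wedge ha, ht, covDerivVec_mulVec B l ht, wedge_zero_right,
    add_zero, twist_apply]

theorem trace_twist_mul_twist [IsAddTorsionFree R] (ha : a.IsSymm) (hP : a.IsSkewAdjoint P)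
    (hQ : a.IsSkewAdjoint Q) (t : n → R) (μ : R) :
    (twist a t μ P * twist a t μ Q).trace = (P * Q).trace
      - (4 * μ + 2 * μ ^ 2 * (t ⬝ᵥ (a *ᵥ t))) * ((P *ᵥ t) ⬝ᵥ (a *ᵥ (Q *ᵥ t))) := by
  have hwt : wedge a (P *ᵥ t) t *ᵥ t = (t ⬝ᵥ (a *ᵥ t)) • (P *ᵥ t) := by
    rw [wedge_mulVec, dotProduct_comm _ t, dotProduct_comm _ t,
      dotProduct_mulVec_self_of_isSkewAdjoint ha hP, zero_smul, sub_zero]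
  rw [twist_apply, twist_apply, Matrix.add_mul, Matrix.mul_add, Matrix.mul_add, trace_add,
    trace_add, trace_add, Matrix.smul_mul, Matrix.smul_mul, Matrix.mul_smul, Matrix.mul_smul]
  simp only [trace_smul, smul_eq_mul]
  rw [trace_mul_comm (wedge a (P *ᵥ t) t) Q, trace_mul_wedge ha hP, trace_mul_wedge ha hQ,
    trace_mul_wedge ha (isSkewAdjoint_wedge ha (P *ᵥ t) t), hwt, smul_dotProduct, smul_eq_mul,
    dotProduct_mulVec_comm_of_isSymm ha (Q *ᵥ t)]
  ring

end Twist

end FinslerAngle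

/-! ### The Cartan tensor of a conformal pair -/

namespace FinslerAngle

open Matrix

theorem koszul_add_self {ι W : Type*} [AddCommGroup W] {K S : ι → ι → ι → W}
    (hS : ∀ k n m, S k n m = K k n m + K k m n) (hK : ∀ k n m, K k n m = K m n k) (k n m : ι) :
    K k n m + K k n m = S k n m + S m n k - S n m k := by
  rw [hS, hS, hS, hK m n k, hK m k n, hK n m k]
  abel

variable {𝕜 R : Type*} [CommRing 𝕜] [CommRing R] [Algebra 𝕜 R] {ι n : Type*}

section Cartan

variable [Fintype n] {V : n → Derivation 𝕜 R R} {a g : Matrix n n R} {t q : n → R} {c w : R}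

theorem map_derivation_conformal (ha : ∀ k m n, V k (a m n) = 0)
    (hg : g = c • ((fibreJacobian V t)ᵀ * a * fibreJacobian V t))
    (hc : ∀ k, V k c = 2 * w * q k * c) (k : n) :
    g.map (V k) = (2 * w * q k) • g
      + c • (((fibreJacobian V t).map (V k))ᵀ * a * fibreJacobian V t)
      + c • ((fibreJacobian V t)ᵀ * a * (fibreJacobian V t).map (V k)) := by
  have haV : a.map (V k) = 0 := Matrix.ext fun m n => ha k m n
  rw [hg, map_derivation_smul, map_derivation_mul, map_derivation_mul, haV, hc, transpose_map,
    smul_smul, Matrix.mul_zero, add_zero, smul_add]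
  abel

theorem inv_fibreJacobian_eq [DecidableEq n] (hT : IsUnit (fibreJacobian V t).det)
    (hgu : IsUnit g.det)
    (hg : g = c • ((fibreJacobian V t)ᵀ * a * fibreJacobian V t)) :
    (fibreJacobian V t)⁻¹ = g⁻¹ * (c • ((fibreJacobian V t)ᵀ * a)) := by
  have h : g * (fibreJacobian V t)⁻¹ = c • ((fibreJacobian V t)ᵀ * a) := by
    rw [hg, Matrix.smul_mul, mul_nonsing_inv_cancel_right _ _ hT]
  rw [← h, nonsing_inv_mul_cancel_left _ _ hgu]

variable [Invertible (2 : 𝕜)]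

/-- The matrices `C_k = (1/2) ∂g/∂y^k` of the Cartan tensor of `g`. -/
def cartanMatrix (V : n → Derivation 𝕜 R R) (g : Matrix n n R) (k : n) : Matrix n n R :=
  ⅟(2 : 𝕜) • g.map (V k)

/-- `C` is totally symmetric and so is `∂T` in its fibre indices, hence a Koszul permutation
expresses `TᵀaT_k` through `C_k`. -/
theorem conformal_mul_map_fibreJacobian (hV : ∀ k m φ, V k (V m φ) = V m (V k φ))
    (ha : ∀ k m n, V k (a m n) = 0) (hsymm : a.IsSymm)
    (hg : g = c • ((fibreJacobian V t)ᵀ * a * fibreJacobian V t))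
    (hc : ∀ k, V k c = 2 * w * q k * c) (hC : ∀ k m n, V k (g m n) = V m (g k n)) (k : n) :
    c • ((fibreJacobian V t)ᵀ * a * (fibreJacobian V t).map (V k)) =
      cartanMatrix V g k
        - w • (q k • g + vecMulVec (g.col k) q - vecMulVec q (g.col k)) := by
  set K : n → Matrix n n R :=
    fun k => c • ((fibreJacobian V t)ᵀ * a * (fibreJacobian V t).map (V k))
  have hgs : g.IsSymm := hg ▸ (isSymm_transpose_mul_mul hsymm _).smul c
  have hS (k i j : n) : V k (g i j) - 2 * w * q k * g i j = K k i j + K k j i := by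
    have hT : c • (((fibreJacobian V t).map (V k))ᵀ * a * fibreJacobian V t) = (K k)ᵀ := by
      simp only [K, transpose_smul, transpose_mul, transpose_transpose, hsymm.eq, Matrix.mul_assoc]
    have h := congrFun₂ (map_derivation_conformal ha hg hc k) i j
    simp only [hT, map_apply, Matrix.add_apply, Matrix.smul_apply _ g, transpose_apply,
      smul_eq_mul] at h
    rw [h]
    ring
  have hK (k i j : n) : K k i j = K j i k := by
    simp only [K, Matrix.smul_apply, Matrix.mul_apply (N := map _ _), map_apply, fibreJacobian,
      of_apply, hV k j]
  change K k = _
  ext i j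
  have hC' (j i : n) : V j (g i k) = V k (g i j) := by
    rw [hgs.apply, hC, hgs.apply]
  have hsum : K k i j + K k i j =
      V k (g i j) - (w * (q k * g i j + g i k * q j - q i * g j k) +
        w * (q k * g i j + g i k * q j - q i * g j k)) := by
    rw [koszul_add_self hS hK, hC', hC', hgs.apply i j]
    ring
  simp only [cartanMatrix, Matrix.sub_apply, Matrix.add_apply, Matrix.smul_apply, map_apply,
    vecMulVec_apply, col_apply, smul_eq_mul]
  rw [eq_sub_iff_add_eq, eq_comm, invOf_smul_eq_iff, ofNat_smul_eq_nsmul, two_nsmul]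
  linear_combination -hsum

end Cartan

section Curvature

variable [Invertible (2 : 𝕜)] [Fintype n] [DecidableEq n]

/-- The curvature tensor `ρ_{ij} = E_{ij} - M^h_{ij} C_h` of the nonlinear connection `c` in a space
with metric tensor `g`. -/
noncomputable def finslerCurvature (X : ι → Derivation 𝕜 R R) (V : n → Derivation 𝕜 R R)
    (c : ι → n → R) (g : Matrix n n R) (i j : ι) : Matrix n n R :=
  curvature (horizontal X V c) (verticalConnection V c) i j
    - of fun m k => (g⁻¹ *ᵥ (cartanMatrix V g k *ᵥ nonlinearCurvature X V c i j)) m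

variable {X : ι → Derivation 𝕜 R R} {V : n → Derivation 𝕜 R R} {c : ι → n → R}
  {Γ : ι → Matrix n n R} {a g : Matrix n n R} {t y : n → R} {f w : R}

theorem finslerCurvature_swap (i j : ι) :
    finslerCurvature X V c g j i = -finslerCurvature X V c g i j := by
  ext m k
  simp only [finslerCurvature, curvature_swap i j, nonlinearCurvature_swap i j, mulVec_neg,
    Matrix.sub_apply, Matrix.neg_apply, of_apply, Pi.neg_apply]
  ring

theorem finslerCurvature_eq (hXV : CommutingFrames X V) (hΓ : ∀ k l a b, V k (Γ l a b) = 0)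
    (ht : ∀ l, covDerivVec (horizontal X V c) Γ l t = 0) (hT : IsUnit (fibreJacobian V t).det)
    (ha : ∀ k m n, V k (a m n) = 0) (hsymm : a.IsSymm) (hgu : IsUnit g.det)
    (hg : g = f • ((fibreJacobian V t)ᵀ * a * fibreJacobian V t))
    (hf : ∀ k, V k f = 2 * w * (g *ᵥ y) k * f) (hC : ∀ k m n, V k (g m n) = V m (g k n))
    (i j : ι) (hM : (g *ᵥ y) ⬝ᵥ nonlinearCurvature X V c i j = 0) :
    finslerCurvature X V c g i j =
      (fibreJacobian V t)⁻¹ * curvature X Γ i j * fibreJacobian V t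
        - w • wedge g (nonlinearCurvature X V c i j) y := by
  set T := fibreJacobian V t
  set M := nonlinearCurvature X V c i j
  have hE (m k : n) : curvature (horizontal X V c) (verticalConnection V c) i j m k =
      (g⁻¹ *ᵥ ((f • (Tᵀ * a * T.map (V k))) *ᵥ M)) m + (T⁻¹ * curvature X Γ i j * T) m k := by
    have hTE : curvature (horizontal X V c) (verticalConnection V c) i j m k =
        (T⁻¹ *ᵥ fun h =>
          (T * curvature (horizontal X V c) (verticalConnection V c) i j) h k) m := by
      conv_lhs => rw [← nonsing_inv_mul_cancel_left T (curvature _ _ i j) hT]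
      rfl
    have hTg : T⁻¹ * T.map (V k) = g⁻¹ * (f • (Tᵀ * a * T.map (V k))) := by
      rw [inv_fibreJacobian_eq hT hgu hg, Matrix.mul_assoc, Matrix.smul_mul]
    rw [hTE, funext (fibreJacobian_mul_curvature_verticalConnection hXV hΓ ht i j · k),
      mulVec_mulVec, ← hTg, ← mulVec_mulVec, Matrix.mul_assoc]
    exact congrFun (mulVec_add _ _ _) m
  have hK (k : n) : g⁻¹ *ᵥ ((f • (Tᵀ * a * T.map (V k))) *ᵥ M) =
      g⁻¹ *ᵥ (cartanMatrix V g k *ᵥ M) - w • ((g *ᵥ y) k • M - (g *ᵥ M) k • y) := by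
    have hgs : g.IsSymm := hg ▸ (isSymm_transpose_mul_mul hsymm _).smul f
    have hgM : g.col k ⬝ᵥ M = (g *ᵥ M) k := by
      conv_rhs => rw [← hgs.eq]
      rfl
    rw [conformal_mul_map_fibreJacobian hXV.vertical_comm ha hsymm hg hf hC, sub_mulVec,
      smul_mulVec, sub_mulVec, add_mulVec, smul_mulVec, vecMulVec_mulVec, vecMulVec_mulVec, hM, hgM]
    simp only [op_smul_eq_smul, zero_smul, add_zero, mulVec_sub, mulVec_smul, mulVec_mulVec,
      nonsing_inv_mul _ hgu, one_mulVec]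
  ext m k
  simp only [finslerCurvature, Matrix.sub_apply, of_apply, hE, hK, wedge, Pi.sub_apply,
    Pi.smul_apply, Matrix.smul_apply, vecMulVec_apply, smul_eq_mul]
  ring

end Curvature

end FinslerAngle

/-! ### The tensors of a conformally automorphic space -/

namespace ConformallyAutomorphicSpace

open Matrix TopologicalSpace SmoothFun

variable {N : ℕ} (A : ConformallyAutomorphicSpace N)

/-- The domain `D` as an open set, over which the smooth functions of `(x, y)` are taken. -/
def domain : Opens (Coord N × Coord N) := ⟨A.D, A.isOpen_D⟩

section BaseMetric

theorem contDiffOn_a (m n : Fin N) :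
    ContDiffOn ℝ ∞ (fun z : Coord N × Coord N => A.a z.1 m n) A.domain :=
  (A.smooth_a m n).comp contDiffOn_fst fun z hz => A.mem_U_of_mem_D z.1 z.2 hz

/-- The Riemannian metric tensor `a_{mn}`, with entries in the smooth functions on `D`. -/
noncomputable def aMat : Matrix (Fin N) (Fin N) (SmoothFun A.domain) :=
  of fun m n => ofContDiffOn _ (A.contDiffOn_a m n)

theorem represents_a (m n : Fin N) : Represents (fun x _ => A.a x m n) (A.aMat m n) :=
  fun _ => rfl

theorem isSymm_aMat : A.aMat.IsSymm :=
  Matrix.ext fun m n => ext_eval fun z =>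
    (A.posDef_a _ (A.mem_U_of_mem_D _ _ z.2)).isHermitian.apply m n

theorem isUnit_det_aMat : IsUnit A.aMat.det :=
  Represents.isUnit_det (B := fun x _ => A.a x) A.represents_a fun _ hz =>
    (A.posDef_a _ (A.mem_U_of_mem_D _ _ hz)).det_pos.ne'

theorem represents_aUp (m n : Fin N) : Represents (fun x _ => A.aUp m n x) (A.aMat⁻¹ m n) :=
  Represents.matrix_inv (B := fun x _ => A.a x) A.represents_a A.isUnit_det_aMat m n

/-- The matrices `Γ_l = (a^i_{kl})_{ik}` of the Levi-Civita connection. -/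
noncomputable abbrev ΓMat : Fin N → Matrix (Fin N) (Fin N) (SmoothFun A.domain) :=
  christoffelMatrix derivX A.aMat

theorem represents_christoffel (i k n : Fin N) :
    Represents (fun x _ => christoffel A.a i k n x) (A.ΓMat n i k) := by
  have hΓ : A.ΓMat n i k = (1 / 2 : ℝ) • ∑ m, A.aMat⁻¹ i m *
      (derivX n (A.aMat m k) + derivX k (A.aMat m n) - derivX m (A.aMat k n)) := by
    simp only [ΓMat, christoffelMatrix, Matrix.mul_apply, of_apply, Finset.smul_sum,
      mul_smul_comm, invOf_eq_inv, one_div]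
  rw [hΓ]
  exact Represents.const_mul (1 / 2) (Represents.sum fun m => (A.represents_aUp i m).mul
    ((((A.represents_a m k).pdX n).add ((A.represents_a m n).pdX k)).sub
      ((A.represents_a k n).pdX m)))

/-- The matrices `R_{ij} = (a_k^n_{ij})_{nk}` of the Riemannian curvature tensor. -/
noncomputable abbrev RMat : Fin N → Fin N → Matrix (Fin N) (Fin N) (SmoothFun A.domain) :=
  curvature derivX A.ΓMat

theorem represents_riemCurv (n i k m : Fin N) :
    Represents (fun x _ => riemCurv A.a n i k m x) (A.RMat k m i n) := by
  have hR : A.RMat k m i n = derivX k (A.ΓMat m i n) - derivX m (A.ΓMat k i n) +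
      ∑ u, (A.ΓMat m u n * A.ΓMat k i u - A.ΓMat k u n * A.ΓMat m i u) := by
    simp only [RMat, curvature, Matrix.sub_apply, Matrix.add_apply, Matrix.map_apply,
      Matrix.mul_apply, Finset.sum_sub_distrib, mul_comm, add_sub_assoc]
  rw [hR]
  exact (((A.represents_christoffel i n m).pdX k).sub ((A.represents_christoffel i n k).pdX m)).add
    (Represents.sum fun u =>
      ((A.represents_christoffel u n m).mul (A.represents_christoffel i u k)).sub
        ((A.represents_christoffel u n k).mul (A.represents_christoffel i u m)))

end BaseMetric

section Transformation

/-- The transformation `t^m`, as a vector of smooth functions on `D`. -/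
noncomputable def tVec (m : Fin N) : SmoothFun A.domain :=
  ofContDiffOn _ (contDiffOn_pi.1 A.smooth_t m)

/-- The Jacobian matrix `T = (t^m_k)_{mk}`. -/
noncomputable abbrev TMat : Matrix (Fin N) (Fin N) (SmoothFun A.domain) :=
  fibreJacobian derivY A.tVec

theorem represents_t (m : Fin N) : Represents (fun x y => A.t x y m) (A.tVec m) :=
  fun _ => rfl

theorem represents_tD (m k : Fin N) : Represents (A.tD m k) (A.TMat m k) :=
  (A.represents_t m).pdY k

theorem represents_tDD (h k m : Fin N) : Represents (A.tDD h k m) (derivY m (A.TMat h k)) :=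
  (A.represents_tD h k).pdY m

theorem jacobian_yInv_mul_jacobian_t {z : Coord N × Coord N} (hz : z ∈ A.D) :
    jacobian (A.yInv z.1) (A.t z.1 z.2) * jacobian (A.t z.1) z.2 = 1 := by
  have hyInv : DifferentiableAt ℝ (fun z : Coord N × Coord N => A.yInv z.1 z.2)
      (z.1, A.t z.1 z.2) :=
    (A.smooth_yInv.contDiffAt (A.isOpen_D'.mem_nhds (A.t_mem _ _ hz))).differentiableAt (by simp)
  have ht : DifferentiableAt ℝ (fun z : Coord N × Coord N => A.t z.1 z.2) z :=
    (A.smooth_t.contDiffAt (A.isOpen_D.mem_nhds hz)).differentiableAt (by simp)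
  refine jacobian_mul_jacobian_eq_one
    (ht.comp (f := fun y => (z.1, y)) z.2 (by fun_prop))
    (hyInv.comp (f := fun τ => (z.1, τ)) (A.t z.1 z.2) (by fun_prop)) ?_
  filter_upwards [(Continuous.prodMk_right z.1).continuousAt.eventually (A.isOpen_D.mem_nhds hz)]
    with y hy using A.left_inv _ y hy

theorem isUnit_det_TMat : IsUnit A.TMat.det :=
  Represents.isUnit_det (B := fun x y => jacobian (A.t x) y) A.represents_tD fun _ hz =>
    (IsUnit.of_mul_eq_one_right _
      (by rw [← det_mul, A.jacobian_yInv_mul_jacobian_t hz, det_one])).ne_zero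

theorem represents_yD (n m : Fin N) : Represents (A.yD n m) (A.TMat⁻¹ n m) := fun z =>
  (congrFun₂ (inv_eq_left_inv (A.jacobian_yInv_mul_jacobian_t z.2)) n m).symm.trans
    (Represents.matrix_inv (B := fun x y => jacobian (A.t x) y) A.represents_tD
      A.isUnit_det_TMat n m z)

end Transformation

section Connection

/-- The coefficients `N_n = (N^m_n)_m` of the nonlinear connection. -/
noncomputable def NVec (n : Fin N) : Fin N → SmoothFun A.domain :=
  -(A.TMat⁻¹ *ᵥ covDerivVec derivX A.ΓMat n A.tVec)

theorem represents_Nc (m n : Fin N) : Represents (A.Nc m n) (A.NVec n m) :=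
  Represents.neg (Represents.sum fun i => (A.represents_yD m i).mul (((A.represents_t i).pdX n).add
    (Represents.sum fun k => (A.represents_christoffel i k n).mul (A.represents_t k))))

/-- The matrices `D_n = (D^m_{nk})_{mk}`. -/
noncomputable abbrev DMat : Fin N → Matrix (Fin N) (Fin N) (SmoothFun A.domain) :=
  verticalConnection derivY A.NVec

theorem represents_Dc (m n k : Fin N) : Represents (A.Dc m n k) (A.DMat n m k) :=
  ((A.represents_Nc m n).pdY k).neg

/-- The operators `d_i` as derivations. -/
noncomputable abbrev dDeriv : Fin N → Derivation ℝ (SmoothFun A.domain) (SmoothFun A.domain) :=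
  horizontal derivX derivY A.NVec

variable {A} in
theorem represents_d {f : Coord N → Coord N → ℝ} {φ : SmoothFun A.domain} (h : Represents f φ)
    (i : Fin N) : Represents (A.d i f) (A.dDeriv i φ) := by
  rw [horizontal_apply]
  exact (h.pdX i).add (Represents.sum fun k => (A.represents_Nc k i).mul (h.pdY k))

/-- The vectors `M_{ij} = (M^n_{ij})_n`. -/
noncomputable abbrev MVec : Fin N → Fin N → Fin N → SmoothFun A.domain :=
  nonlinearCurvature derivX derivY A.NVec

theorem represents_M (n i j : Fin N) : Represents (A.M n i j) (A.MVec i j n) :=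
  (represents_d (A.represents_Nc n j) i).sub (represents_d (A.represents_Nc n i) j)

/-- The matrices `E_{ij} = (E_k^n_{ij})_{nk}`. -/
noncomputable abbrev EMat : Fin N → Fin N → Matrix (Fin N) (Fin N) (SmoothFun A.domain) :=
  curvature A.dDeriv A.DMat

theorem represents_E (k n i j : Fin N) : Represents (A.E k n i j) (A.EMat i j n k) := by
  have hE : A.EMat i j n k = A.dDeriv i (A.DMat j n k) - A.dDeriv j (A.DMat i n k) +
      ∑ m, (A.DMat j m k * A.DMat i n m - A.DMat i m k * A.DMat j n m) := by
    simp only [EMat, curvature, Matrix.sub_apply, Matrix.add_apply, Matrix.map_apply,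
      Matrix.mul_apply, Finset.sum_sub_distrib, mul_comm, add_sub_assoc]
  rw [hE]
  exact ((represents_d (A.represents_Dc n j k) i).sub (represents_d (A.represents_Dc n i k) j)).add
    (Represents.sum fun m => ((A.represents_Dc m j k).mul (A.represents_Dc n i m)).sub
      ((A.represents_Dc m i k).mul (A.represents_Dc n j m)))

end Connection

section FinslerMetric

/-- The metric function `F`, as a smooth function on `D`. -/
noncomputable def FFun : SmoothFun A.domain := ofContDiffOn _ A.smooth_F

theorem represents_F : Represents A.F A.FFun := fun _ => rfl

/-- The covector `y_k`. -/
noncomputable def yLow (k : Fin N) : SmoothFun A.domain := (1 / 2 : ℝ) • derivY k (A.FFun ^ 2)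

theorem represents_covector (k : Fin N) : Represents (covector A.F k) (A.yLow k) :=
  ((A.represents_F.pow 2).pdY k).const_mul _

/-- The Finsler metric tensor `g_{ij}`, with entries in the smooth functions on `D`. -/
noncomputable def gMat : Matrix (Fin N) (Fin N) (SmoothFun A.domain) :=
  fibreJacobian derivY A.yLow

theorem represents_g (i j : Fin N) : Represents (A.g i j) (A.gMat i j) :=
  (A.represents_covector i).pdY j

theorem isUnit_det_gMat : IsUnit A.gMat.det :=
  Represents.isUnit_det A.represents_g fun _ hz => A.metric_nondegenerate _ _ hz

theorem represents_gUp (i j : Fin N) : Represents (A.gUp i j) (A.gMat⁻¹ i j) :=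
  Represents.matrix_inv A.represents_g A.isUnit_det_gMat i j

theorem represents_C (m n k : Fin N) :
    Represents (A.C m n k) (cartanMatrix derivY A.gMat k m n) := by
  rw [cartanMatrix, invOf_eq_inv, ← one_div]
  exact ((A.represents_g m n).pdY k).const_mul _

theorem represents_CUp (n h k : Fin N) :
    Represents (A.CUp n h k) ((A.gMat⁻¹ * cartanMatrix derivY A.gMat k) n h) :=
  Represents.sum fun m => (A.represents_gUp n m).mul (A.represents_C m h k)

/-- The matrices `ρ_{ij} = (ρ_k^n_{ij})_{nk}`. -/
noncomputable abbrev rhoMat : Fin N → Fin N → Matrix (Fin N) (Fin N) (SmoothFun A.domain) :=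
  finslerCurvature derivX derivY A.NVec A.gMat

theorem represents_rho (k n i j : Fin N) : Represents (A.rho k n i j) (A.rhoMat i j n k) := by
  have hρ : A.rhoMat i j n k = A.EMat i j n k
      - ∑ h, A.MVec i j h * (A.gMat⁻¹ * cartanMatrix derivY A.gMat k) n h := by
    rw [rhoMat, finslerCurvature, Matrix.sub_apply, of_apply, mulVec_mulVec, mulVec, dotProduct]
    simp only [mul_comm]
  rw [hρ]
  exact (A.represents_E k n i j).sub
    (Represents.sum fun h => (A.represents_M h i j).mul (A.represents_CUp n h k))

theorem represents_covM (k n i j : Fin N) : Represents (A.covM k n i j)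
    (covDerivVec A.dDeriv A.DMat k (A.MVec i j) n
      - ∑ s, A.ΓMat i s k * A.MVec s j n - ∑ s, A.ΓMat j s k * A.MVec i s n) :=
  (((represents_d (A.represents_M n i j) k).add
    (Represents.sum fun s => (A.represents_Dc n k s).mul (A.represents_M s i j))).sub
    (Represents.sum fun s => (A.represents_christoffel s k i).mul (A.represents_M n s j))).sub
    (Represents.sum fun s => (A.represents_christoffel s k j).mul (A.represents_M n i s))

theorem represents_covRho (l k n i j : Fin N) : Represents (A.covRho l k n i j)
    (covDeriv A.dDeriv A.DMat l (A.rhoMat i j) n k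
      - ∑ s, A.ΓMat i s l * A.rhoMat s j n k - ∑ s, A.ΓMat j s l * A.rhoMat i s n k) := by
  have hcomm : (A.rhoMat i j * A.DMat l) n k = ∑ s, A.DMat l s k * A.rhoMat i j n s := by
    simp only [Matrix.mul_apply, mul_comm]
  rw [covDeriv, Matrix.sub_apply, Matrix.add_apply, hcomm]
  exact ((((represents_d (A.represents_rho k n i j) l).add
    (Represents.sum fun s => (A.represents_Dc n l s).mul (A.represents_rho k s i j))).sub
    (Represents.sum fun s => (A.represents_Dc s l k).mul (A.represents_rho s n i j))).sub
    (Represents.sum fun s => (A.represents_christoffel s l i).mul (A.represents_rho k n s j))).sub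
    (Represents.sum fun s => (A.represents_christoffel s l j).mul (A.represents_rho k n i s))

end FinslerMetric

end ConformallyAutomorphicSpace

/-! ### The conformal factor and the curvature -/

namespace FinslerAngle

theorem commutingFrames_derivX_derivY {N : ℕ} {Ω : TopologicalSpace.Opens (Coord N × Coord N)} :
    CommutingFrames (derivX (Ω := Ω)) derivY :=
  ⟨fun _ _ => SmoothFun.dirDeriv_comm _ _, fun _ _ => SmoothFun.dirDeriv_comm _ _,
    fun _ _ => SmoothFun.dirDeriv_comm _ _⟩

theorem riemNorm_smul {N : ℕ} (a : Coord N → Matrix (Fin N) (Fin N) ℝ) (x t : Coord N) {k : ℝ}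
    (hk : 0 ≤ k) : riemNorm a x (k • t) = k * riemNorm a x t := by
  have hsum : ∑ m, ∑ n, a x m n * (k • t) m * (k • t) n =
      k ^ 2 * ∑ m, ∑ n, a x m n * t m * t n := by
    simp only [Finset.mul_sum, Pi.smul_apply, smul_eq_mul]
    exact Finset.sum_congr rfl fun m _ => Finset.sum_congr rfl fun n _ => by ring
  rw [riemNorm, hsum, Real.sqrt_mul (sq_nonneg k), Real.sqrt_sq hk, riemNorm]

end FinslerAngle

namespace ConformallyAutomorphicSpace

open Matrix TopologicalSpace SmoothFun

variable {N : ℕ} (A : ConformallyAutomorphicSpace N)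

theorem derivY_aMat (k m n : Fin N) : derivY k (A.aMat m n) = 0 :=
  (A.represents_a m n).derivY_eq_zero k

theorem derivY_ΓMat (k l i j : Fin N) : derivY k (A.ΓMat l i j) = 0 :=
  (A.represents_christoffel i j l).derivY_eq_zero k

theorem isMetricConnection_horizontal : IsMetricConnection A.dDeriv A.ΓMat A.aMat :=
  (isMetricConnection_christoffelMatrix A.isSymm_aMat A.isUnit_det_aMat).horizontal A.derivY_aMat

theorem covDerivVec_tVec (l : Fin N) : covDerivVec A.dDeriv A.ΓMat l A.tVec = 0 :=
  covDerivVec_horizontal_eq_zero A.isUnit_det_TMat (fun _ => rfl) l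

theorem isSkewAdjoint_RMat (i j : Fin N) : A.aMat.IsSkewAdjoint (A.RMat i j) :=
  (isMetricConnection_christoffelMatrix A.isSymm_aMat A.isUnit_det_aMat).isSkewAdjoint_curvature
    commutingFrames_derivX_derivY.base_comm i j

theorem MVec_eq (i j : Fin N) : A.MVec i j = -(A.TMat⁻¹ *ᵥ (A.RMat i j *ᵥ A.tVec)) :=
  nonlinearCurvature_eq commutingFrames_derivX_derivY A.derivY_ΓMat A.covDerivVec_tVec
    A.isUnit_det_TMat i j

section Homogeneity

theorem TMat_mulVec_coordY : A.TMat *ᵥ coordY = A.H • A.tVec :=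
  funext fun m => (A.represents_t m).euler fun z hz k hk =>
    congrFun (A.t_homog z.1 z.2 hz k hk) m

theorem isUnit_FFun : IsUnit A.FFun :=
  A.represents_F.isUnit fun z hz => (A.F_pos z.1 z.2 hz).ne'

theorem yLow_eq (k : Fin N) : A.yLow k = A.FFun * derivY k A.FFun := by
  rw [yLow, pow_two, Derivation.leibniz, smul_eq_mul, ← two_smul ℝ, smul_smul]
  norm_num

theorem yLow_dotProduct_coordY : A.yLow ⬝ᵥ coordY = A.FFun ^ 2 := by
  have heuler : ∑ i, derivY i A.FFun * coordY i = (1 : ℝ) • A.FFun :=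
    A.represents_F.euler fun z hz k hk => by rw [Real.rpow_one, A.F_homog z.1 z.2 hz k hk]
  rw [one_smul] at heuler
  simp only [dotProduct, yLow_eq, mul_assoc, ← Finset.mul_sum, heuler]
  ring

theorem derivY_yLow_comm (k m : Fin N) : derivY k (A.yLow m) = derivY m (A.yLow k) := by
  rw [yLow, yLow, Derivation.map_smul, Derivation.map_smul,
    commutingFrames_derivX_derivY.vertical_comm]

theorem isSymm_gMat : A.gMat.IsSymm :=
  Matrix.ext fun i j => A.derivY_yLow_comm i j

theorem gMat_mulVec_coordY : A.gMat *ᵥ coordY = A.yLow := funext fun k => by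
  have hderiv := congrArg (derivY k) A.yLow_dotProduct_coordY
  have htwo : derivY k (A.FFun ^ 2) = A.yLow k + A.yLow k := by
    rw [yLow, ← add_smul]
    norm_num
  rw [derivation_dotProduct, derivY_comp_coordY, dotProduct_single_one, htwo,
    add_left_inj] at hderiv
  rw [← hderiv]
  exact congrArg (· ⬝ᵥ coordY) (funext fun j => A.derivY_yLow_comm j k)

/-- The squared length `S² = a_{mn} t^m t^n` of the transformed vector. -/
noncomputable def sqLen : SmoothFun A.domain := A.tVec ⬝ᵥ (A.aMat *ᵥ A.tVec)

theorem riemNorm_t {x y : Coord N} (hxy : (x, y) ∈ A.D) :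
    riemNorm A.a x (A.t x y) = A.F x y ^ A.H := by
  have hF := A.F_pos x y hxy
  have hunit : A.F x ((A.F x y)⁻¹ • y) = 1 := by
    rw [A.F_homog x y hxy _ (inv_pos.2 hF), inv_mul_cancel₀ hF.ne']
  rw [A.indicatrix _ _ (A.smul_mem_D x y hxy _ (inv_pos.2 hF)),
    A.t_homog x y hxy _ (inv_pos.2 hF), riemNorm_smul _ _ _ (by positivity),
    Real.inv_rpow hF.le] at hunit
  exact (inv_mul_eq_one₀ (Real.rpow_pos_of_pos hF _).ne').1 hunit |>.symm

theorem represents_sqLen : Represents (fun x y => riemNorm A.a x (A.t x y) ^ 2) A.sqLen := by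
  have hsum : A.sqLen = ∑ m, ∑ n, A.aMat m n * A.tVec m * A.tVec n := by
    simp only [sqLen, dotProduct, mulVec, Finset.mul_sum, mul_comm, mul_left_comm]
  rw [hsum]
  intro z
  rw [← Represents.sum (fun m => Represents.sum fun n =>
    ((A.represents_a m n).mul (A.represents_t m)).mul (A.represents_t n)) z]
  have hpos : 0 < riemNorm A.a z.1.1 (A.t z.1.1 z.1.2) := by
    rw [A.riemNorm_t z.2]
    exact Real.rpow_pos_of_pos (A.F_pos _ _ z.2) _
  exact Real.sq_sqrt (Real.sqrt_pos.1 hpos).le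

theorem isUnit_sqLen : IsUnit A.sqLen :=
  A.represents_sqLen.isUnit fun z hz => by
    rw [A.riemNorm_t hz]
    exact pow_ne_zero _ (Real.rpow_pos_of_pos (A.F_pos _ _ hz) _).ne'

end Homogeneity

section ConformalFactor

theorem contDiffOn_F_rpow (α : ℝ) :
    ContDiffOn ℝ ∞ (fun z : Coord N × Coord N => A.F z.1 z.2 ^ α) A.domain :=
  A.smooth_F.rpow_const_of_ne fun z hz => (A.F_pos z.1 z.2 hz).ne'

/-- The function `p = F^{1-H}/H`; its square is the conformal factor. -/
noncomputable def pFun : SmoothFun A.domain :=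
  (1 / A.H) • ofContDiffOn _ (A.contDiffOn_F_rpow (1 - A.H))

theorem represents_p : Represents A.p A.pFun :=
  Represents.const_mul (f := fun x y => A.F x y ^ (1 - A.H)) (1 / A.H) fun _ => rfl

theorem isUnit_pFun : IsUnit A.pFun :=
  A.represents_p.isUnit fun z hz =>
    (mul_pos (one_div_pos.2 A.H_pos) (Real.rpow_pos_of_pos (A.F_pos z.1 z.2 hz) _)).ne'

theorem H_sq_smul_pFun_sq_mul_sqLen : A.H ^ 2 • (A.pFun ^ 2 * A.sqLen) = A.FFun ^ 2 :=
  ext_eval fun z => by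
    have hF := A.F_pos _ _ z.2
    have hrpow : A.F z.1.1 z.1.2 ^ (1 - A.H) * A.F z.1.1 z.1.2 ^ A.H = A.F z.1.1 z.1.2 := by
      rw [← Real.rpow_add hF, sub_add_cancel, Real.rpow_one]
    simp only [map_smul, map_mul, map_pow, ← A.represents_p z, ← A.represents_sqLen z,
      ← A.represents_F z, A.riemNorm_t z.2, smul_eq_mul, p]
    conv_rhs => rw [← hrpow]
    field_simp [A.H_pos.ne']

theorem gMat_eq : A.gMat = A.pFun ^ 2 • (A.TMatᵀ * A.aMat * A.TMat) := by
  obtain ⟨c, hc⟩ := A.conformal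
  set B := A.TMatᵀ * A.aMat * A.TMat with hB
  have hsum (m n : Fin N) : B m n = ∑ i, ∑ j, A.aMat i j * A.TMat i m * A.TMat j n := by
    simp only [hB, Matrix.mul_apply, transpose_apply, Finset.sum_mul]
    rw [Finset.sum_comm]
    simp only [mul_comm (A.TMat _ m)]
  have hconf (z : A.domain) (m n : Fin N) :
      eval z (A.gMat m n) = c z.1.1 z.1.2 * eval z (B m n) := by
    rw [hsum, ← A.represents_g m n z, ← Represents.sum (fun i => Represents.sum fun j =>
      ((A.represents_a i j).mul (A.represents_tD i m)).mul (A.represents_tD j n)) z]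
    exact (hc _ _ z.2).2 m n
  have hBy : coordY ⬝ᵥ (B *ᵥ coordY) = A.H ^ 2 • A.sqLen := by
    rw [hB, ← mulVec_mulVec, ← mulVec_mulVec, dotProduct_transpose_mulVec, TMat_mulVec_coordY,
      mulVec_smul, smul_dotProduct, dotProduct_smul, smul_smul, ← pow_two, dotProduct_comm, sqLen]
  ext1 m n
  refine ext_eval fun z => ?_
  have hgy : eval z (coordY ⬝ᵥ (A.gMat *ᵥ coordY)) =
      c z.1.1 z.1.2 * eval z (coordY ⬝ᵥ (B *ᵥ coordY)) := by
    simp only [dotProduct, mulVec, map_sum, map_mul, hconf, Finset.mul_sum, mul_assoc,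
      mul_left_comm]
  rw [gMat_mulVec_coordY, dotProduct_comm, yLow_dotProduct_coordY, hBy,
    ← H_sq_smul_pFun_sq_mul_sqLen, map_smul, map_smul, map_mul, smul_eq_mul, smul_eq_mul,
    mul_left_comm (c _ _)] at hgy
  have hH : A.H ^ 2 ≠ 0 := pow_ne_zero 2 A.H_pos.ne'
  have hcp := mul_right_cancel₀ (A.isUnit_sqLen.map (eval z)).ne_zero (mul_left_cancel₀ hH hgy)
  rw [hconf, ← hcp, Matrix.smul_apply, smul_eq_mul, map_mul]

/-- The factor `w = (1 - H)/F²` in `∂p/∂y^k = w y_k p`. -/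
noncomputable def logDerivFactor : SmoothFun A.domain := (1 - A.H) • Ring.inverse A.FFun ^ 2

theorem derivY_pFun_sq (k : Fin N) :
    derivY k (A.pFun ^ 2) = 2 * A.logDerivFactor * A.yLow k * A.pFun ^ 2 := by
  have hrpow : A.FFun * derivY k A.pFun = (1 - A.H) • (A.pFun * derivY k A.FFun) := by
    rw [pFun, Derivation.map_smul, mul_smul_comm, A.represents_F.derivY_rpow (fun _ => rfl)
      fun z hz => (A.F_pos z.1 z.2 hz).ne', smul_mul_assoc, smul_comm]
  have hp : derivY k A.pFun = (1 - A.H) • (Ring.inverse A.FFun * (A.pFun * derivY k A.FFun)) := by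
    rw [← mul_smul_comm, ← hrpow, Ring.inverse_mul_cancel_left _ _ A.isUnit_FFun]
  have hF : Ring.inverse A.FFun ^ 2 * A.FFun = Ring.inverse A.FFun := by
    rw [pow_two, mul_assoc, Ring.inverse_mul_cancel _ A.isUnit_FFun, mul_one]
  rw [pow_two, Derivation.leibniz, hp, yLow_eq, logDerivFactor]
  simp only [smul_eq_mul, Algebra.smul_def]
  linear_combination (-2 * algebraMap ℝ _ (1 - A.H) * A.pFun ^ 2 * derivY k A.FFun) * hF

end ConformalFactor

section Curvature

theorem yLow_eq_smul : A.yLow = (A.H • A.pFun ^ 2) • (A.TMatᵀ *ᵥ (A.aMat *ᵥ A.tVec)) := by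
  rw [← gMat_mulVec_coordY, gMat_eq, smul_mulVec, ← mulVec_mulVec, ← mulVec_mulVec,
    TMat_mulVec_coordY, mulVec_smul, mulVec_smul, smul_comm, smul_assoc]

theorem gMat_mulVec_MVec (i j : Fin N) :
    A.gMat *ᵥ A.MVec i j = -(A.pFun ^ 2 • (A.TMatᵀ *ᵥ (A.aMat *ᵥ (A.RMat i j *ᵥ A.tVec)))) := by
  rw [MVec_eq, gMat_eq, mulVec_neg, smul_mulVec, ← mulVec_mulVec, ← mulVec_mulVec,
    mulVec_mulVec _ A.TMat, mul_nonsing_inv _ A.isUnit_det_TMat, one_mulVec]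

theorem yLow_dotProduct_MVec (i j : Fin N) : A.yLow ⬝ᵥ A.MVec i j = 0 := by
  have hskew := dotProduct_mulVec_self_of_isSkewAdjoint A.isSymm_aMat (A.isSkewAdjoint_RMat i j)
    A.tVec
  rw [MVec_eq, yLow_eq_smul, smul_dotProduct, dotProduct_neg, dotProduct_comm,
    dotProduct_transpose_mulVec, mulVec_mulVec _ A.TMat, mul_nonsing_inv _ A.isUnit_det_TMat,
    one_mulVec, dotProduct_comm _ (A.RMat i j *ᵥ A.tVec),
    dotProduct_mulVec_comm_of_isSymm A.isSymm_aMat, hskew, neg_zero, smul_zero]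

theorem rhoMat_eq_sub_wedge (i j : Fin N) : A.rhoMat i j =
    A.TMat⁻¹ * A.RMat i j * A.TMat - A.logDerivFactor • wedge A.gMat (A.MVec i j) coordY := by
  refine finslerCurvature_eq commutingFrames_derivX_derivY A.derivY_ΓMat A.covDerivVec_tVec
    A.isUnit_det_TMat A.derivY_aMat A.isSymm_aMat A.isUnit_det_gMat A.gMat_eq ?_ ?_ i j ?_
  · rw [gMat_mulVec_coordY]
    exact A.derivY_pFun_sq
  · intro k m n
    rw [← A.isSymm_gMat.apply m n, ← A.isSymm_gMat.apply k n]
    exact commutingFrames_derivX_derivY.vertical_comm k m _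
  · rw [gMat_mulVec_coordY]
    exact A.yLow_dotProduct_MVec i j

/-- The coefficient `(1 - H)/(H S²)` of the bivector term in the curvature. -/
noncomputable def twistFactor : SmoothFun A.domain := A.H • (A.logDerivFactor * A.pFun ^ 2)

theorem twistFactor_mul_sqLen :
    A.twistFactor * A.sqLen = algebraMap ℝ _ ((1 - A.H) / A.H) := by
  have hF : Ring.inverse A.FFun ^ 2 * A.FFun ^ 2 = 1 := by
    rw [← mul_pow, Ring.inverse_mul_cancel _ A.isUnit_FFun, one_pow]
  have hH : A.H • (A.pFun ^ 2 * A.sqLen) = A.H⁻¹ • A.FFun ^ 2 := by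
    rw [← H_sq_smul_pFun_sq_mul_sqLen, smul_smul, pow_two A.H,
      inv_mul_cancel_left₀ A.H_pos.ne']
  rw [twistFactor, smul_mul_assoc, mul_assoc, ← mul_smul_comm, hH, logDerivFactor,
    smul_mul_smul_comm, hF, Algebra.algebraMap_eq_smul_one, div_eq_mul_inv]

theorem inv_TMat_mul_twist_mul (B : Matrix (Fin N) (Fin N) (SmoothFun A.domain)) :
    A.TMat⁻¹ * twist A.aMat A.tVec A.twistFactor B * A.TMat = A.TMat⁻¹ * B * A.TMat
      - A.logDerivFactor • wedge A.gMat (-(A.TMat⁻¹ *ᵥ (B *ᵥ A.tVec))) coordY := by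
  have hy : coordY = A.H • (A.TMat⁻¹ *ᵥ A.tVec) := by
    rw [← mulVec_smul, ← TMat_mulVec_coordY, mulVec_mulVec, nonsing_inv_mul _ A.isUnit_det_TMat,
      one_mulVec]
  rw [twist_apply, Matrix.mul_add, Matrix.add_mul, Matrix.mul_smul, Matrix.smul_mul,
    inv_mul_wedge_mul A.isUnit_det_TMat, sub_eq_add_neg, gMat_eq, wedge_smul_form,
    ← neg_one_smul (SmoothFun A.domain) (A.TMat⁻¹ *ᵥ _), hy,
    ← algebraMap_smul (SmoothFun A.domain) A.H (_ *ᵥ _), wedge_smul_right, wedge_smul_left,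
    twistFactor]
  simp only [neg_smul, one_smul, smul_neg, neg_neg, smul_smul]
  congr 2
  rw [Algebra.smul_def]
  ring

theorem rhoMat_eq (i j : Fin N) : A.rhoMat i j =
    A.TMat⁻¹ * twist A.aMat A.tVec A.twistFactor (A.RMat i j) * A.TMat := by
  rw [rhoMat_eq_sub_wedge, MVec_eq, inv_TMat_mul_twist_mul]

theorem dDeriv_twistFactor (l : Fin N) : A.dDeriv l A.twistFactor = 0 := by
  have hS : A.dDeriv l A.sqLen = 0 := by
    rw [sqLen, A.isMetricConnection_horizontal.derivation_dotProduct_mulVec, covDerivVec_tVec,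
      mulVec_zero, zero_dotProduct, dotProduct_zero, add_zero]
  have h := congrArg (A.dDeriv l) A.twistFactor_mul_sqLen
  rw [Derivation.leibniz, hS, smul_zero, zero_add, Derivation.map_algebraMap, smul_eq_mul] at h
  exact A.isUnit_sqLen.mul_right_eq_zero.1 h

end Curvature

end ConformallyAutomorphicSpace

/-! ### Contractions -/

namespace FinslerAngle

open Matrix

variable {R : Type*} [CommRing R] {n : Type*} [Fintype n]

section Raise

variable {W W' : Type*} [AddCommGroup W] [Module R W] [AddCommGroup W'] [Module R W']

/-- The family obtained from `B_{ij}` by raising both indices with the matrix `b`. -/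
def raise (b : Matrix n n R) (B : n → n → W) (i j : n) : W :=
  ∑ m, ∑ r, (b m i * b r j) • B m r

theorem raise_map {f : W → W'} (hf : IsLinearMap R f) (b : Matrix n n R) (B : n → n → W)
    (i j : n) : raise b (fun i j => f (B i j)) i j = f (raise b B i j) := by
  rw [← hf.mk'_apply (raise b B i j), raise, raise, map_sum]
  simp only [map_sum, map_smul, IsLinearMap.mk'_apply]

end Raise

section Contraction

variable {a b P T : Matrix n n R}

theorem mul_wedge (a : Matrix n n R) (u v : n → R) :
    a * wedge a u v = vecMulVec (a *ᵥ u) (a *ᵥ v) - vecMulVec (a *ᵥ v) (a *ᵥ u) := by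
  rw [wedge, Matrix.mul_sub, mul_vecMulVec, mul_vecMulVec]

theorem wedge_mul_inv [DecidableEq n] (ha : a.IsSymm) (hu : IsUnit a.det) (u v : n → R) :
    wedge a u v * a⁻¹ = vecMulVec u v - vecMulVec v u := by
  have h (w : n → R) : (a *ᵥ w) ᵥ* a⁻¹ = w := by
    rw [← ha.eq, mulVec_transpose, ha.eq, vecMul_vecMul, mul_nonsing_inv _ hu, vecMul_one]
  rw [wedge, Matrix.sub_mul, vecMulVec_mul, vecMulVec_mul, h, h]

theorem isSkewAdjoint_conj [DecidableEq n] (hT : IsUnit T.det) (hP : a.IsSkewAdjoint P) (c : R) :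
    (c • (Tᵀ * a * T)).IsSkewAdjoint (T⁻¹ * P * T) := by
  have hPa : Pᵀ * a = a * -P := hP
  rw [Matrix.IsSkewAdjoint, Matrix.IsAdjointPair, Matrix.mul_smul, Matrix.smul_mul]
  congr 1
  calc (T⁻¹ * P * T)ᵀ * (Tᵀ * a * T) = Tᵀ * (Pᵀ * (T * T⁻¹)ᵀ * a) * T := by
        simp only [transpose_mul, Matrix.mul_assoc]
    _ = Tᵀ * a * (T * T⁻¹) * -P * T := by
        rw [mul_nonsing_inv _ hT, transpose_one, Matrix.mul_one, hPa, Matrix.mul_one,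
          Matrix.mul_assoc Tᵀ a]
    _ = Tᵀ * a * T * -(T⁻¹ * P * T) := by
        simp only [Matrix.mul_assoc, Matrix.mul_neg, Matrix.neg_mul]

theorem sum_sum_mul_sum_sum_eq_dotProduct (P Q : n → n → Matrix n n R) (u : n → R) :
    ∑ l, ∑ h, ∑ k, ∑ i, ∑ j, u l * P i j k l * (u h * Q i j k h) =
      ∑ i, ∑ j, (P i j *ᵥ u) ⬝ᵥ (Q i j *ᵥ u) := by
  have hdot (i j : n) : (P i j *ᵥ u) ⬝ᵥ (Q i j *ᵥ u) =
      ∑ l, ∑ h, ∑ k, u l * P i j k l * (u h * Q i j k h) := by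
    simp only [dotProduct, mulVec, Finset.sum_mul_sum, mul_comm (u _)]
    rw [Finset.sum_comm]
    exact Finset.sum_congr rfl fun l _ => Finset.sum_comm
  simp only [hdot]
  simpa only [Fintype.sum_prod_type] using Finset.sum_comm (s := (.univ : Finset (n × n × n)))
    (t := (.univ : Finset (n × n)))
    (f := fun x z => u x.1 * P z.1 z.2 x.2.2 x.1 * (u x.2.1 * Q z.1 z.2 x.2.2 x.2.1))

theorem sum_raise_mul_lower [DecidableEq n] (hb : b.IsSymm) (hu : IsUnit b.det)
    (P : n → n → Matrix n n R) {Q : n → n → Matrix n n R} (hQ : ∀ i j, b.IsSkewAdjoint (Q i j)) :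
    ∑ k, ∑ m, ∑ i, ∑ j, (P i j * b⁻¹) m k * (b * Q i j) m k =
      -∑ i, ∑ j, (P i j * Q i j).trace := by
  have htrace (i j : n) : ∑ k, ∑ m, (P i j * b⁻¹) m k * (b * Q i j) m k =
      -(P i j * Q i j).trace := by
    rw [← trace_raise_mul_lower hu (hQ i j), ← hb.eq, ← transpose_mul, hb.eq, Finset.sum_comm]
    rfl
  rw [← Finset.sum_neg_distrib]
  simp only [← Finset.sum_neg_distrib, ← htrace]
  simpa only [Fintype.sum_prod_type] using Finset.sum_comm (s := (.univ : Finset (n × n)))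
    (t := (.univ : Finset (n × n)))
    (f := fun x z => (P z.1 z.2 * b⁻¹) x.2 x.1 * (b * Q z.1 z.2) x.2 x.1)

end Contraction

end FinslerAngle

namespace ConformallyAutomorphicSpace

open Matrix TopologicalSpace SmoothFun

variable {N : ℕ} (A : ConformallyAutomorphicSpace N)

section Representatives

theorem represents_MUp (n i j : Fin N) :
    Represents (A.MUp n i j) (raise A.aMat⁻¹ A.MVec i j n) := by
  simp only [raise, Finset.sum_apply, Pi.smul_apply, smul_eq_mul]
  exact Represents.sum fun m => Represents.sum fun r =>
    ((A.represents_aUp m i).mul (A.represents_aUp r j)).mul (A.represents_M n m r)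

theorem represents_MLow (n i j : Fin N) :
    Represents (A.MLow n i j) ((A.gMat *ᵥ A.MVec i j) n) :=
  Represents.sum fun m => (A.represents_g n m).mul (A.represents_M m i j)

theorem represents_rhoLow (k n i j : Fin N) :
    Represents (A.rhoLow k n i j) ((A.gMat * A.rhoMat i j) n k) := by
  simp only [Matrix.mul_apply, ← A.isSymm_gMat.apply n]
  exact Represents.sum fun m => (A.represents_g m n).mul (A.represents_rho k m i j)

theorem represents_rhoUp (k n i j : Fin N) :
    Represents (A.rhoUp k n i j) ((raise A.aMat⁻¹ A.rhoMat i j * A.gMat⁻¹) n k) := by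
  have hsum : (raise A.aMat⁻¹ A.rhoMat i j * A.gMat⁻¹) n k = ∑ q, ∑ m, ∑ r,
      A.gMat⁻¹ q k * A.aMat⁻¹ m i * A.aMat⁻¹ r j * A.rhoMat m r n q := by
    simp only [Matrix.mul_apply, raise, Matrix.sum_apply, Matrix.smul_apply, smul_eq_mul,
      Finset.sum_mul]
    exact Finset.sum_congr rfl fun q _ => Finset.sum_congr rfl fun m _ =>
      Finset.sum_congr rfl fun r _ => by ring
  rw [hsum]
  exact Represents.sum fun q => Represents.sum fun m => Represents.sum fun r =>
    (((A.represents_gUp q k).mul (A.represents_aUp m i)).mul (A.represents_aUp r j)).mul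
      (A.represents_rho q n m r)

theorem represents_riemCurvLow (h l i j : Fin N) :
    Represents (fun x _ => riemCurvLow A.a h l i j x) ((A.aMat * A.RMat i j) l h) :=
  Represents.sum fun r => (A.represents_a l r).mul (A.represents_riemCurv h r i j)

theorem represents_riemCurvMid (h n i j : Fin N) :
    Represents (fun x _ => riemCurvMid A.a h n i j x) (raise A.aMat⁻¹ A.RMat i j n h) := by
  simp only [raise, Matrix.sum_apply, Matrix.smul_apply, smul_eq_mul]
  exact Represents.sum fun m => Represents.sum fun r =>
    ((A.represents_aUp m i).mul (A.represents_aUp r j)).mul (A.represents_riemCurv h n m r)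

theorem isSymm_inv_aMat : A.aMat⁻¹.IsSymm := by
  rw [Matrix.IsSymm, transpose_nonsing_inv, A.isSymm_aMat.eq]

theorem represents_riemCurvUp (h r i j : Fin N) : Represents
    (fun x _ => riemCurvUp A.a h r i j x) ((raise A.aMat⁻¹ A.RMat i j * A.aMat⁻¹) r h) := by
  have hsum : (raise A.aMat⁻¹ A.RMat i j * A.aMat⁻¹) r h =
      ∑ l, A.aMat⁻¹ h l * raise A.aMat⁻¹ A.RMat i j r l := by
    simp only [Matrix.mul_apply, mul_comm, A.isSymm_inv_aMat.apply h]
  rw [hsum]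
  exact Represents.sum fun l => (A.represents_aUp h l).mul (A.represents_riemCurvMid l r i j)

/-- The contraction `t^l a_l^{nij} t^h a_{hnij}`. -/
noncomputable def tCurvSq : SmoothFun A.domain :=
  ∑ i, ∑ j, (raise A.aMat⁻¹ A.RMat i j *ᵥ A.tVec) ⬝ᵥ (A.aMat *ᵥ (A.RMat i j *ᵥ A.tVec))

theorem represents_Q : Represents A.Q A.tCurvSq := by
  simp only [tCurvSq, mulVec_mulVec, ← sum_sum_mul_sum_sum_eq_dotProduct]
  exact Represents.sum fun l => Represents.sum fun h => Represents.sum fun n =>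
    Represents.sum fun i => Represents.sum fun j =>
      ((A.represents_t l).mul (A.represents_riemCurvMid l n i j)).mul
        ((A.represents_t h).mul (A.represents_riemCurvLow h n i j))

theorem represents_lLow (k : Fin N) :
    Represents (A.lLow k) (A.yLow k * Ring.inverse A.FFun) :=
  (A.represents_covector k).div A.represents_F A.isUnit_FFun

theorem represents_lUp (k : Fin N) : Represents (A.lUp k) (coordY k * Ring.inverse A.FFun) :=
  (represents_coordY k).div A.represents_F A.isUnit_FFun

theorem represents_sub_one_div_F :
    Represents (fun x y => -(1 - A.H) * (1 / A.F x y)) (-((1 - A.H) • Ring.inverse A.FFun)) := by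
  rw [← neg_smul, ← one_mul (Ring.inverse _), ← map_one (algebraMap ℝ (SmoothFun A.domain))]
  exact ((Represents.const 1).div A.represents_F A.isUnit_FFun).const_mul _

end Representatives

section FinslerCurvature

theorem raise_MVec (i j : Fin N) : raise A.aMat⁻¹ A.MVec i j =
    -(A.TMat⁻¹ *ᵥ (raise A.aMat⁻¹ A.RMat i j *ᵥ A.tVec)) := by
  have hlin : IsLinearMap (SmoothFun A.domain)
      fun B : Matrix (Fin N) (Fin N) (SmoothFun A.domain) => -(A.TMat⁻¹ *ᵥ (B *ᵥ A.tVec)) :=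
    ⟨fun B C => by rw [add_mulVec, mulVec_add, neg_add],
      fun c B => by rw [smul_mulVec, mulVec_smul, smul_neg]⟩
  rw [← raise_map hlin]
  exact congrArg (raise _ · i j) (funext₂ A.MVec_eq)

theorem raise_rhoMat (i j : Fin N) : raise A.aMat⁻¹ A.rhoMat i j = A.TMat⁻¹ *
    twist A.aMat A.tVec A.twistFactor (raise A.aMat⁻¹ A.RMat i j) * A.TMat := by
  have hlin : IsLinearMap (SmoothFun A.domain) fun B =>
      A.TMat⁻¹ * twist A.aMat A.tVec A.twistFactor B * A.TMat :=
    ⟨fun B C => by rw [map_add, Matrix.mul_add, Matrix.add_mul],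
      fun c B => by rw [map_smul, Matrix.mul_smul, Matrix.smul_mul]⟩
  rw [← raise_map hlin]
  exact congrArg (raise _ · i j) (funext₂ A.rhoMat_eq)

theorem isSkewAdjoint_rhoMat (i j : Fin N) : A.gMat.IsSkewAdjoint (A.rhoMat i j) := by
  rw [rhoMat_eq, gMat_eq]
  exact isSkewAdjoint_conj A.isUnit_det_TMat
    (isSkewAdjoint_twist A.isSymm_aMat (A.isSkewAdjoint_RMat i j) _ _) _

theorem gMat_mul_rhoMat (i j : Fin N) : A.gMat * A.rhoMat i j =
    A.pFun ^ 2 • (A.TMatᵀ * (A.aMat * A.RMat i j) * A.TMat)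
      - A.logDerivFactor • (vecMulVec (A.gMat *ᵥ A.MVec i j) A.yLow
        - vecMulVec A.yLow (A.gMat *ᵥ A.MVec i j)) := by
  have hmain : A.gMat * (A.TMat⁻¹ * A.RMat i j * A.TMat) =
      A.pFun ^ 2 • (A.TMatᵀ * (A.aMat * A.RMat i j) * A.TMat) := by
    rw [gMat_eq, Matrix.smul_mul]
    simp only [Matrix.mul_assoc, mul_nonsing_inv_cancel_left _ _ A.isUnit_det_TMat]
  rw [rhoMat_eq_sub_wedge, Matrix.mul_sub, hmain, Matrix.mul_smul, mul_wedge, gMat_mulVec_coordY]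

theorem TMat_mul_inv_gMat : A.TMat * A.gMat⁻¹ =
    Ring.inverse (A.pFun ^ 2) • (A.aMat⁻¹ * A.TMat⁻¹ᵀ) := by
  have hTT : A.TMatᵀ * A.TMat⁻¹ᵀ = 1 := by
    rw [← transpose_mul, nonsing_inv_mul _ A.isUnit_det_TMat, transpose_one]
  have hg : A.gMat * (Ring.inverse (A.pFun ^ 2) • (A.TMat⁻¹ * A.aMat⁻¹ * A.TMat⁻¹ᵀ)) = 1 := by
    rw [gMat_eq, Matrix.mul_smul, Matrix.smul_mul, smul_smul,
      Ring.inverse_mul_cancel _ (A.isUnit_pFun.pow 2), one_smul]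
    simp only [Matrix.mul_assoc, mul_nonsing_inv_cancel_left _ _ A.isUnit_det_TMat,
      mul_nonsing_inv_cancel_left _ _ A.isUnit_det_aMat, hTT]
  rw [inv_eq_right_inv hg, Matrix.mul_smul, Matrix.mul_assoc A.TMat⁻¹,
    mul_nonsing_inv_cancel_left _ _ A.isUnit_det_TMat]

theorem raise_rhoMat_mul_inv_gMat (i j : Fin N) : raise A.aMat⁻¹ A.rhoMat i j * A.gMat⁻¹ =
    Ring.inverse (A.pFun ^ 2) •
        (A.TMat⁻¹ * (raise A.aMat⁻¹ A.RMat i j * A.aMat⁻¹) * A.TMat⁻¹ᵀ)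
      - A.logDerivFactor • (vecMulVec (raise A.aMat⁻¹ A.MVec i j) coordY
        - vecMulVec coordY (raise A.aMat⁻¹ A.MVec i j)) := by
  rw [raise_rhoMat, inv_TMat_mul_twist_mul, ← raise_MVec, Matrix.sub_mul, Matrix.smul_mul,
    wedge_mul_inv A.isSymm_gMat A.isUnit_det_gMat, Matrix.mul_assoc _ A.TMat, TMat_mul_inv_gMat,
    Matrix.mul_smul]
  simp only [Matrix.mul_assoc]

theorem trace_raise_rhoMat_mul_rhoMat (i j : Fin N) :
    (raise A.aMat⁻¹ A.rhoMat i j * A.rhoMat i j).trace =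
      (raise A.aMat⁻¹ A.RMat i j * A.RMat i j).trace
        - (4 * A.twistFactor + 2 * A.twistFactor ^ 2 * A.sqLen)
          * ((raise A.aMat⁻¹ A.RMat i j *ᵥ A.tVec) ⬝ᵥ (A.aMat *ᵥ (A.RMat i j *ᵥ A.tVec))) := by
  have hraise : A.aMat.IsSkewAdjoint (raise A.aMat⁻¹ A.RMat i j) := by
    rw [← mem_skewAdjointMatricesSubmodule]
    exact sum_mem fun m _ => sum_mem fun r _ => Submodule.smul_mem _ _
      ((mem_skewAdjointMatricesSubmodule _ _).2 (A.isSkewAdjoint_RMat m r))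
  rw [raise_rhoMat, rhoMat_eq, Matrix.mul_assoc, Matrix.mul_assoc A.TMat⁻¹ _ A.TMat,
    mul_nonsing_inv_cancel_left _ _ A.isUnit_det_TMat, trace_mul_comm, Matrix.mul_assoc,
    mul_nonsing_inv_cancel_left _ _ A.isUnit_det_TMat, trace_mul_comm,
    trace_twist_mul_twist A.isSymm_aMat hraise (A.isSkewAdjoint_RMat i j), sqLen]

theorem trace_form_coefficient_mul_sqLen :
    (4 * A.twistFactor + 2 * A.twistFactor ^ 2 * A.sqLen) * A.sqLen =
      algebraMap ℝ _ (2 * ((A.H ^ 2)⁻¹ - 1)) := by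
  have hH : 4 * ((1 - A.H) / A.H) + 2 * ((1 - A.H) / A.H) ^ 2 = 2 * ((A.H ^ 2)⁻¹ - 1) := by
    field_simp [A.H_pos.ne']
    ring
  rw [← hH, map_add, map_mul, map_mul, map_pow, ← twistFactor_mul_sqLen, map_ofNat, map_ofNat]
  ring

theorem TMat_map_dDeriv (l : Fin N) :
    A.TMat.map (A.dDeriv l) = A.TMat * A.DMat l - A.ΓMat l * A.TMat :=
  fibreJacobian_map_horizontal commutingFrames_derivX_derivY A.derivY_ΓMat (A.covDerivVec_tVec l)

theorem covDeriv_RMat (l i j : Fin N) :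
    covDeriv A.dDeriv A.ΓMat l (A.RMat i j) = covDeriv derivX A.ΓMat l (A.RMat i j) :=
  covDeriv_horizontal (fun k => vertical_curvature commutingFrames_derivX_derivY.mixed_comm
    A.derivY_ΓMat k i j) l

theorem covDerivVec_MVec (l i j : Fin N) : covDerivVec A.dDeriv A.DMat l (A.MVec i j) =
    A.TMat⁻¹ *ᵥ (covDeriv derivX A.ΓMat l (A.RMat j i) *ᵥ A.tVec) := by
  rw [MVec_eq, ← mulVec_neg, ← neg_mulVec, ← curvature_swap i j,
    covDerivVec_inv_mulVec A.isUnit_det_TMat (A.TMat_map_dDeriv l),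
    covDerivVec_mulVec _ l (A.covDerivVec_tVec l), covDeriv_RMat]

theorem covDeriv_rhoMat (l i j : Fin N) : covDeriv A.dDeriv A.DMat l (A.rhoMat i j) =
    A.TMat⁻¹ * twist A.aMat A.tVec A.twistFactor (covDeriv derivX A.ΓMat l (A.RMat i j))
      * A.TMat := by
  rw [rhoMat_eq, covDeriv_conj A.isUnit_det_TMat (A.TMat_map_dDeriv l),
    covDeriv_twist A.isMetricConnection_horizontal (A.covDerivVec_tVec l) (A.dDeriv_twistFactor l),
    covDeriv_RMat]

theorem covDerivVec_MVec_cyclic (l i j : Fin N) :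
    covDerivVec A.dDeriv A.DMat l (A.MVec i j) + covDerivVec A.dDeriv A.DMat j (A.MVec l i)
      + covDerivVec A.dDeriv A.DMat i (A.MVec j l) = 0 := by
  rw [covDerivVec_MVec, covDerivVec_MVec, covDerivVec_MVec, ← mulVec_add, ← mulVec_add,
    ← add_mulVec, ← add_mulVec, add_right_comm,
    curvature_bianchi commutingFrames_derivX_derivY.base_comm l j i, zero_mulVec, mulVec_zero]

theorem covDeriv_rhoMat_cyclic (l i j : Fin N) :
    covDeriv A.dDeriv A.DMat l (A.rhoMat i j) + covDeriv A.dDeriv A.DMat j (A.rhoMat l i)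
      + covDeriv A.dDeriv A.DMat i (A.rhoMat j l) = 0 := by
  rw [covDeriv_rhoMat, covDeriv_rhoMat, covDeriv_rhoMat, ← Matrix.add_mul, ← Matrix.mul_add,
    ← map_add, ← Matrix.add_mul, ← Matrix.mul_add, ← map_add,
    curvature_bianchi commutingFrames_derivX_derivY.base_comm, map_zero, Matrix.mul_zero,
    Matrix.zero_mul]

end FinslerCurvature

end ConformallyAutomorphicSpace

/-! ### Components -/

namespace FinslerAngle

open Matrix

theorem transpose_mul_mul_apply {ι R : Type*} [Fintype ι] [CommSemiring R]
    (S X : Matrix ι ι R) (n k : ι) :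
    (Sᵀ * X * S) n k = ∑ h, ∑ l, X l h * S h k * S l n := by
  simp only [Matrix.mul_apply, transpose_apply, Finset.sum_mul]
  exact Finset.sum_congr rfl fun h _ => Finset.sum_congr rfl fun l _ => by ring

end FinslerAngle

namespace ConformallyAutomorphicSpace

open Matrix SmoothFun

variable {N : ℕ} (A : ConformallyAutomorphicSpace N) {x y : Coord N} (hxy : (x, y) ∈ A.D)

include hxy

theorem M_eq (n i j : Fin N) : A.M n i j x y =
    -∑ s, ∑ h, A.yD n s x y * A.t x y h * riemCurv A.a h s i j x := by
  refine (A.represents_M n i j).eq_of_eq (Represents.neg (Represents.sum fun s =>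
    Represents.sum fun h => ((A.represents_yD n s).mul (A.represents_t h)).mul
      (A.represents_riemCurv h s i j))) ?_ hxy
  simp only [MVec_eq, Pi.neg_apply, mulVec, dotProduct, Finset.mul_sum, mul_assoc,
    mul_comm (A.tVec _)]

theorem E_eq (k n i j : Fin N) : A.E k n i j x y =
    ∑ h, ∑ m, A.yD n h x y * A.tDD h k m x y * A.M m i j x y
      + ∑ m, ∑ h, A.yD n m x y * riemCurv A.a h m i j x * A.tD h k x y := by
  refine (A.represents_E k n i j).eq_of_eq (Represents.add
    (Represents.sum fun h => Represents.sum fun m =>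
      ((A.represents_yD n h).mul (A.represents_tDD h k m)).mul (A.represents_M m i j))
    (Represents.sum fun m => Represents.sum fun h =>
      ((A.represents_yD n m).mul (A.represents_riemCurv h m i j)).mul (A.represents_tD h k)))
    ?_ hxy
  have hT (h m : Fin N) : derivY k (A.TMat h m) = derivY m (A.TMat h k) :=
    commutingFrames_derivX_derivY.vertical_comm k m _
  rw [← nonsing_inv_mul_cancel_left _ (A.EMat i j) A.isUnit_det_TMat, Matrix.mul_apply]
  simp only [fibreJacobian_mul_curvature_verticalConnection commutingFrames_derivX_derivY
    A.derivY_ΓMat A.covDerivVec_tVec i j]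
  simp only [Matrix.mul_apply, mulVec, dotProduct, map_apply, hT, mul_add,
    Finset.sum_add_distrib, Finset.mul_sum, mul_assoc]

theorem rhoLow_eq (k n i j : Fin N) : A.rhoLow k n i j x y =
    -(1 - A.H) * (1 / A.F x y) *
        (A.lLow k x y * A.MLow n i j x y - A.lLow n x y * A.MLow k i j x y)
      + A.p x y ^ 2 * ∑ h, ∑ l, riemCurvLow A.a h l i j x * A.tD h k x y * A.tD l n x y := by
  refine (A.represents_rhoLow k n i j).eq_of_eq ((A.represents_sub_one_div_F.mul
    (((A.represents_lLow k).mul (A.represents_MLow n i j)).sub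
      ((A.represents_lLow n).mul (A.represents_MLow k i j)))).add
    ((A.represents_p.pow 2).mul (Represents.sum fun h => Represents.sum fun l =>
      ((A.represents_riemCurvLow h l i j).mul (A.represents_tD h k)).mul
        (A.represents_tD l n)))) ?_ hxy
  rw [gMat_mul_rhoMat, Matrix.sub_apply, Matrix.smul_apply, transpose_mul_mul_apply,
    Matrix.smul_apply, Matrix.sub_apply, vecMulVec_apply, vecMulVec_apply, logDerivFactor]
  simp only [smul_eq_mul, Algebra.smul_def]
  ring

theorem rho_eq (k n i j : Fin N) : A.rho k n i j x y =
    -(1 - A.H) * (1 / A.F x y) *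
        ∑ m, (A.lLow k x y * (if n = m then 1 else 0) - A.lUp n x y * A.g m k x y)
          * A.M m i j x y
      + ∑ m, ∑ h, A.yD n m x y * riemCurv A.a h m i j x * A.tD h k x y := by
  have hδ (m : Fin N) : Represents (Ω := A.domain) (fun _ _ => if n = m then 1 else 0)
      (algebraMap ℝ _ (if n = m then 1 else 0)) := Represents.const _
  refine (A.represents_rho k n i j).eq_of_eq ((A.represents_sub_one_div_F.mul
    (Represents.sum fun m => ((((A.represents_lLow k).mul (hδ m)).sub
      ((A.represents_lUp n).mul (A.represents_g m k))).mul (A.represents_M m i j)))).add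
    (Represents.sum fun m => Represents.sum fun h =>
      ((A.represents_yD n m).mul (A.represents_riemCurv h m i j)).mul (A.represents_tD h k)))
    ?_ hxy
  have hfirst : ∑ m, (A.yLow k * Ring.inverse A.FFun * algebraMap ℝ _ (if n = m then 1 else 0)
        - coordY n * Ring.inverse A.FFun * A.gMat m k) * A.MVec i j m =
      Ring.inverse A.FFun * (A.yLow k * A.MVec i j n - coordY n * (A.gMat *ᵥ A.MVec i j) k) := by
    simp only [apply_ite (algebraMap ℝ (SmoothFun A.domain)), map_one, map_zero, mul_ite, mul_one,
      mul_zero, sub_mul, ite_mul, zero_mul, Finset.sum_sub_distrib, Finset.sum_ite_eq,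
      Finset.mem_univ, if_true, A.isSymm_gMat.apply k, mul_assoc, ← Finset.mul_sum]
    rw [mulVec, dotProduct]
    ring
  have hsecond : (A.TMat⁻¹ * A.RMat i j * A.TMat) n k =
      ∑ m, ∑ h, A.TMat⁻¹ n m * A.RMat i j m h * A.TMat h k := by
    rw [Finset.sum_comm]
    simp only [Matrix.mul_apply, Finset.sum_mul]
  rw [hfirst, ← hsecond, rhoMat_eq_sub_wedge, Matrix.sub_apply, Matrix.smul_apply, wedge,
    Matrix.sub_apply, vecMulVec_apply, vecMulVec_apply, gMat_mulVec_coordY, logDerivFactor]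
  simp only [smul_eq_mul, Algebra.smul_def]
  ring

theorem rhoUp_eq (k n i j : Fin N) : A.rhoUp k n i j x y =
    -(1 - A.H) * (1 / A.F x y) *
        (A.lUp k x y * A.MUp n i j x y - A.lUp n x y * A.MUp k i j x y)
      + 1 / A.p x y ^ 2 *
        ∑ h, ∑ r, A.yD k h x y * A.yD n r x y * riemCurvUp A.a h r i j x := by
  refine (A.represents_rhoUp k n i j).eq_of_eq ((A.represents_sub_one_div_F.mul
    (((A.represents_lUp k).mul (A.represents_MUp n i j)).sub
      ((A.represents_lUp n).mul (A.represents_MUp k i j)))).add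
    (((Represents.const 1).div (A.represents_p.pow 2) (A.isUnit_pFun.pow 2)).mul
      (Represents.sum fun h => Represents.sum fun r =>
        ((A.represents_yD k h).mul (A.represents_yD n r)).mul
          (A.represents_riemCurvUp h r i j)))) ?_ hxy
  have hsum : (A.TMat⁻¹ * (raise A.aMat⁻¹ A.RMat i j * A.aMat⁻¹) * A.TMat⁻¹ᵀ) n k =
      ∑ h, ∑ r, A.TMat⁻¹ k h * A.TMat⁻¹ n r * (raise A.aMat⁻¹ A.RMat i j * A.aMat⁻¹) r h := by
    have hmul := transpose_mul_mul_apply A.TMat⁻¹ᵀ (raise A.aMat⁻¹ A.RMat i j * A.aMat⁻¹) n k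
    rw [transpose_transpose] at hmul
    rw [hmul]
    exact Finset.sum_congr rfl fun h _ => Finset.sum_congr rfl fun r _ => by
      rw [transpose_apply, transpose_apply]; ring
  rw [raise_rhoMat_mul_inv_gMat, Matrix.sub_apply, Matrix.smul_apply, hsum, Matrix.smul_apply,
    Matrix.sub_apply, vecMulVec_apply, vecMulVec_apply, logDerivFactor]
  simp only [smul_eq_mul, Algebra.smul_def, map_one]
  ring

theorem MLow_eq (n i j : Fin N) : A.MLow n i j x y =
    -A.p x y ^ 2 * ∑ h, ∑ m, A.t x y h * A.tD m n x y * riemCurvLow A.a h m i j x := by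
  refine (A.represents_MLow n i j).eq_of_eq ((A.represents_p.pow 2).neg.mul
    (Represents.sum fun h => Represents.sum fun m => ((A.represents_t h).mul
      (A.represents_tD m n)).mul (A.represents_riemCurvLow h m i j))) ?_ hxy
  rw [gMat_mulVec_MVec, mulVec_mulVec _ A.aMat, Pi.neg_apply, Pi.smul_apply, smul_eq_mul, neg_mul,
    Finset.sum_comm]
  simp only [mulVec, dotProduct, transpose_apply, Finset.mul_sum, mul_left_comm, mul_comm,
    mul_assoc]

theorem sum_MUp_mul_MLow :
    ∑ n, ∑ i, ∑ j, A.MUp n i j x y * A.MLow n i j x y = A.p x y ^ 2 * A.Q x y := by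
  refine (Represents.sum fun n => Represents.sum fun i => Represents.sum fun j =>
    (A.represents_MUp n i j).mul (A.represents_MLow n i j)).eq_of_eq
    ((A.represents_p.pow 2).mul A.represents_Q) ?_ hxy
  have hdot (i j : Fin N) : raise A.aMat⁻¹ A.MVec i j ⬝ᵥ (A.gMat *ᵥ A.MVec i j) = A.pFun ^ 2 *
      ((raise A.aMat⁻¹ A.RMat i j *ᵥ A.tVec) ⬝ᵥ (A.aMat *ᵥ (A.RMat i j *ᵥ A.tVec))) := by
    rw [raise_MVec, gMat_mulVec_MVec, neg_dotProduct_neg, dotProduct_smul,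
      dotProduct_transpose_mulVec, mulVec_mulVec _ A.TMat, mul_nonsing_inv _ A.isUnit_det_TMat,
      one_mulVec, dotProduct_comm, smul_eq_mul]
  simp only [tCurvSq, Finset.mul_sum, ← hdot]
  rw [Finset.sum_comm]
  exact Finset.sum_congr rfl fun i _ => Finset.sum_comm

theorem rhoLow_antisymm (m n i j : Fin N) :
    A.rhoLow m n i j x y = -A.rhoLow n m i j x y := by
  refine (A.represents_rhoLow m n i j).eq_of_eq (A.represents_rhoLow n m i j).neg ?_ hxy
  have hskew : (A.rhoMat i j)ᵀ * A.gMat = A.gMat * -A.rhoMat i j := A.isSkewAdjoint_rhoMat i j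
  rw [← neg_apply, ← Matrix.mul_neg, ← hskew, ← A.isSymm_gMat.eq, ← transpose_mul,
    A.isSymm_gMat.eq, transpose_apply]

theorem covM_cyclic (k n i j : Fin N) :
    A.covM k n i j x y + A.covM j n k i x y + A.covM i n j k x y = 0 := by
  refine (((A.represents_covM k n i j).add (A.represents_covM j n k i)).add
    (A.represents_covM i n j k)).eq_of_eq (Represents.const 0) ?_ hxy
  have hM : covDerivVec A.dDeriv A.DMat k (A.MVec i j) n
      + covDerivVec A.dDeriv A.DMat j (A.MVec k i) n
      + covDerivVec A.dDeriv A.DMat i (A.MVec j k) n = 0 :=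
    congrFun (A.covDerivVec_MVec_cyclic k i j) n
  have hΓ := cyclic_sum_connection_smul_eq_zero (christoffelMatrix_symm (X := derivX) A.isSymm_aMat)
    (B := fun i j => A.MVec i j n) (fun i j => congrFun (nonlinearCurvature_swap i j) n) k i j
  simp only [smul_eq_mul] at hΓ
  rw [map_zero]
  linear_combination hM - hΓ

theorem covRho_cyclic (l k n i j : Fin N) :
    A.covRho l k n i j x y + A.covRho j k n l i x y + A.covRho i k n j l x y = 0 := by
  refine (((A.represents_covRho l k n i j).add (A.represents_covRho j k n l i)).add
    (A.represents_covRho i k n j l)).eq_of_eq (Represents.const 0) ?_ hxy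
  have hρ : covDeriv A.dDeriv A.DMat l (A.rhoMat i j) n k
      + covDeriv A.dDeriv A.DMat j (A.rhoMat l i) n k
      + covDeriv A.dDeriv A.DMat i (A.rhoMat j l) n k = 0 :=
    congrFun₂ (A.covDeriv_rhoMat_cyclic l i j) n k
  have hΓ := cyclic_sum_connection_smul_eq_zero (christoffelMatrix_symm (X := derivX) A.isSymm_aMat)
    (B := fun i j => A.rhoMat i j n k) (fun i j => congrFun₂ (finslerCurvature_swap i j) n k) l i j
  simp only [smul_eq_mul] at hΓ
  rw [map_zero]
  linear_combination hρ - hΓ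

theorem sum_rhoUp_mul_rhoLow :
    ∑ k, ∑ n, ∑ i, ∑ j, A.rhoUp k n i j x y * A.rhoLow k n i j x y =
      ∑ k, ∑ n, ∑ i, ∑ j, riemCurvUp A.a k n i j x * riemCurvLow A.a k n i j x
        + 2 / riemNorm A.a x (A.t x y) ^ 2 * ((A.H ^ 2)⁻¹ - 1) * A.Q x y := by
  refine (Represents.sum fun k => Represents.sum fun n => Represents.sum fun i =>
    Represents.sum fun j => (A.represents_rhoUp k n i j).mul
      (A.represents_rhoLow k n i j)).eq_of_eq ((Represents.sum fun k => Represents.sum fun n =>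
    Represents.sum fun i => Represents.sum fun j => (A.represents_riemCurvUp k n i j).mul
      (A.represents_riemCurvLow k n i j)).add ((((Represents.const 2).div A.represents_sqLen
    A.isUnit_sqLen).mul (Represents.const _)).mul A.represents_Q)) ?_ hxy
  have hcoeff : 4 * A.twistFactor + 2 * A.twistFactor ^ 2 * A.sqLen =
      algebraMap ℝ _ 2 * Ring.inverse A.sqLen * algebraMap ℝ _ ((A.H ^ 2)⁻¹ - 1) := by
    refine A.isUnit_sqLen.mul_right_cancel ?_
    rw [trace_form_coefficient_mul_sqLen, map_mul, mul_right_comm _ _ A.sqLen,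
      mul_assoc (algebraMap ℝ _ 2), Ring.inverse_mul_cancel _ A.isUnit_sqLen, mul_one]
  rw [sum_raise_mul_lower A.isSymm_gMat A.isUnit_det_gMat _ A.isSkewAdjoint_rhoMat,
    sum_raise_mul_lower A.isSymm_aMat A.isUnit_det_aMat _ A.isSkewAdjoint_RMat, tCurvSq]
  simp only [trace_raise_rhoMat_mul_rhoMat, hcoeff, Finset.sum_sub_distrib, ← Finset.mul_sum]
  ring

end ConformallyAutomorphicSpace

theorem mainTheorem6_general {N : ℕ} (A : ConformallyAutomorphicSpace N)
    (x y : Coord N) (hxy : (x, y) ∈ A.D) :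
    (∀ n i j, A.M n i j x y =
      -∑ s, ∑ h, A.yD n s x y * A.t x y h * riemCurv A.a h s i j x) ∧
    (∀ k n i j, A.E k n i j x y =
      ∑ h, ∑ m, A.yD n h x y * A.tDD h k m x y * A.M m i j x y
        + ∑ m, ∑ h, A.yD n m x y * riemCurv A.a h m i j x * A.tD h k x y) ∧
    (∀ k n i j, A.rhoLow k n i j x y =
      -(1 - A.H) * (1 / A.F x y) *
          (A.lLow k x y * A.MLow n i j x y - A.lLow n x y * A.MLow k i j x y)
        + A.p x y ^ 2 * ∑ h, ∑ l, riemCurvLow A.a h l i j x * A.tD h k x y * A.tD l n x y) ∧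
    (∀ k n i j, A.rho k n i j x y =
      -(1 - A.H) * (1 / A.F x y) *
          ∑ m, (A.lLow k x y * (if n = m then 1 else 0) - A.lUp n x y * A.g m k x y)
            * A.M m i j x y
        + ∑ m, ∑ h, A.yD n m x y * riemCurv A.a h m i j x * A.tD h k x y) ∧
    (∀ k n i j, A.rhoUp k n i j x y =
      -(1 - A.H) * (1 / A.F x y) *
          (A.lUp k x y * A.MUp n i j x y - A.lUp n x y * A.MUp k i j x y)
        + 1 / A.p x y ^ 2 *
          ∑ h, ∑ r, A.yD k h x y * A.yD n r x y * riemCurvUp A.a h r i j x) ∧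
    (∀ n i j, A.MLow n i j x y =
      -A.p x y ^ 2 * ∑ h, ∑ m, A.t x y h * A.tD m n x y * riemCurvLow A.a h m i j x) ∧
    (∑ n, ∑ i, ∑ j, A.MUp n i j x y * A.MLow n i j x y = A.p x y ^ 2 * A.Q x y) ∧
    (∀ m n i j, A.rhoLow m n i j x y = -A.rhoLow n m i j x y) ∧
    (∀ k n i j, A.covM k n i j x y + A.covM j n k i x y + A.covM i n j k x y = 0) ∧
    (∀ l k n i j,
      A.covRho l k n i j x y + A.covRho j k n l i x y + A.covRho i k n j l x y = 0) ∧
    (∑ k, ∑ n, ∑ i, ∑ j, A.rhoUp k n i j x y * A.rhoLow k n i j x y =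
      ∑ k, ∑ n, ∑ i, ∑ j, riemCurvUp A.a k n i j x * riemCurvLow A.a k n i j x
        + 2 / riemNorm A.a x (A.t x y) ^ 2 * ((A.H ^ 2)⁻¹ - 1) * A.Q x y) :=
  ⟨A.M_eq hxy, A.E_eq hxy, A.rhoLow_eq hxy, A.rho_eq hxy, A.rhoUp_eq hxy, A.MLow_eq hxy,
    A.sum_MUp_mul_MLow hxy, A.rhoLow_antisymm hxy, A.covM_cyclic hxy, A.covRho_cyclic hxy,
    A.sum_rhoUp_mul_rhoLow hxy⟩

theorem mainTheorem6 {N : ℕ} (hN : 3 ≤ N) (A : ConformallyAutomorphicSpace N)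
    (x y : Coord N) (hxy : (x, y) ∈ A.D) :
    (∀ n i j, A.M n i j x y =
      -∑ s, ∑ h, A.yD n s x y * A.t x y h * riemCurv A.a h s i j x) ∧
    (∀ k n i j, A.E k n i j x y =
      ∑ h, ∑ m, A.yD n h x y * A.tDD h k m x y * A.M m i j x y
        + ∑ m, ∑ h, A.yD n m x y * riemCurv A.a h m i j x * A.tD h k x y) ∧
    (∀ k n i j, A.rhoLow k n i j x y =
      -(1 - A.H) * (1 / A.F x y) *
          (A.lLow k x y * A.MLow n i j x y - A.lLow n x y * A.MLow k i j x y)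
        + A.p x y ^ 2 * ∑ h, ∑ l, riemCurvLow A.a h l i j x * A.tD h k x y * A.tD l n x y) ∧
    (∀ k n i j, A.rho k n i j x y =
      -(1 - A.H) * (1 / A.F x y) *
          ∑ m, (A.lLow k x y * (if n = m then 1 else 0) - A.lUp n x y * A.g m k x y)
            * A.M m i j x y
        + ∑ m, ∑ h, A.yD n m x y * riemCurv A.a h m i j x * A.tD h k x y) ∧
    (∀ k n i j, A.rhoUp k n i j x y =
      -(1 - A.H) * (1 / A.F x y) *
          (A.lUp k x y * A.MUp n i j x y - A.lUp n x y * A.MUp k i j x y)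
        + 1 / A.p x y ^ 2 *
          ∑ h, ∑ r, A.yD k h x y * A.yD n r x y * riemCurvUp A.a h r i j x) ∧
    (∀ n i j, A.MLow n i j x y =
      -A.p x y ^ 2 * ∑ h, ∑ m, A.t x y h * A.tD m n x y * riemCurvLow A.a h m i j x) ∧
    (∑ n, ∑ i, ∑ j, A.MUp n i j x y * A.MLow n i j x y = A.p x y ^ 2 * A.Q x y) ∧
    (∀ m n i j, A.rhoLow m n i j x y = -A.rhoLow n m i j x y) ∧
    (∀ k n i j, A.covM k n i j x y + A.covM j n k i x y + A.covM i n j k x y = 0) ∧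
    (∀ l k n i j,
      A.covRho l k n i j x y + A.covRho j k n l i x y + A.covRho i k n j l x y = 0) ∧
    (∑ k, ∑ n, ∑ i, ∑ j, A.rhoUp k n i j x y * A.rhoLow k n i j x y =
      ∑ k, ∑ n, ∑ i, ∑ j, riemCurvUp A.a k n i j x * riemCurvLow A.a k n i j x
        + 2 / riemNorm A.a x (A.t x y) ^ 2 * ((A.H ^ 2)⁻¹ - 1) * A.Q x y) :=
  mainTheorem6_general A x y hxy
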